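/- Let $G=(V,E)$ be a finite connected simple graph that is regular of degree $\Delta\ge 2$ and has diameter $D$, and let $s\in V$. Consider the synchronous protocol PULL with unbounded FIFO buffers. Initially only the source $s$ is informed, i.e. has the rumor, and all buffers are empty. In each step, every uninformed node sends a request to a neighbor chosen uniformly at random, independently of the other choices of this step and of everything that has happened before. These requests, and the copies of the rumor that were sent at the end of the previous step, are delivered and appended to the buffers of their addressees; the order among messages delivered to the same node in the same step is arbitrary (it may be fixed, random, or chosen by an adversary who knows the past and the random choices of this step, but not the future choices). Then every node whose buffer is nonempty removes and reads the first message of its buffer. An uninformed node that reads the rumor becomes informed. A node that was already informed and reads a request answers it in the same step by sending a copy of the rumor to the requester. All other messages that are read are discarded. There is an absolute constant $C$, independent of $G$, $D$, $\Delta$, $s$ and of the way ties are broken, such that the expected number of steps until every node is informed is at most $C\,D^2\,\Delta\log\Delta$. -/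

import Mathlib

open MeasureTheory
open scoped ENNReal

namespace BufferPull

/-- A message is a pull request, which carries the identity of its sender, or the rumor. -/
inductive Msg (V : Type*) where
  | request (sender : V) : Msg V
  | rumor : Msg V

/-- The state of the network at the end of a step. `buffer v` is the FIFO queue of `v`, with the
oldest message first; `answer w = some u` means that in this step `w` has answered a request of
`u`, so that a copy of the rumor is on its way from `w` to `u`. -/
structure Config (V : Type*) where
  informed : Set V
  buffer : V → List (Msg V)
  answer : V → Option V

/-- At the beginning only the source has the rumor, and there are no messages. -/
def Config.initial {V : Type*} (s : V) : Config V where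
  informed := {s}
  buffer := fun _ => []
  answer := fun _ => none

open Classical in
/-- The messages delivered to `v` in the step that follows `σ`: one request from every uninformed
node `u` whose random choice `c u` is `v`, and the answers on their way to `v`. -/
noncomputable def Config.arrivals {V : Type*} [Fintype V] (σ : Config V) (c : V → V) (v : V) :
    Multiset (Msg V) :=
  (Finset.univ.filter fun u => u ∉ σ.informed ∧ c u = v).val.map Msg.request +
    Multiset.replicate (Finset.univ.filter fun w => σ.answer w = some v).card Msg.rumor

open Classical in
/-- The reading phase. Every node `v` whose queue `q v` is nonempty removes and reads the first
message of its queue. A node that reads the rumor is informed from then on. A node that is already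
informed and reads a request answers it. Every other message that is read is discarded. -/
noncomputable def Config.read {V : Type*} (σ : Config V) (q : V → List (Msg V)) : Config V where
  informed := {v | v ∈ σ.informed ∨ (q v).head? = some Msg.rumor}
  buffer := fun v => (q v).tail
  answer := fun v =>
    if v ∈ σ.informed then
      match (q v).head? with
      | some (Msg.request u) => some u
      | _ => none
    else none

/-- `Step σ c σ'`: one synchronous step of the protocol, with the random choices `c`, can lead from
`σ` to `σ'`. The messages delivered to a node are appended to its buffer in an arbitrary order
(ties are broken arbitrarily), and then every node reads one message. -/
def Step {V : Type*} [Fintype V] (σ : Config V) (c : V → V) (σ' : Config V) : Prop :=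
  ∃ new : V → List (Msg V), (∀ v, (new v : Multiset (Msg V)) = σ.arrivals c v) ∧
    σ' = σ.read fun v => σ.buffer v ++ new v

/-- `conf` is a (random) synchronous execution of PULL on `G` with source `s`, and `choice t ω v` is
the neighbor that `v` selects in step `t + 1` (the choice is used only if `v` is uninformed).
Given the history `ℱ t` of the first `t` steps, the choices in step `t + 1` are independent
and uniform over the neighborhoods. The order in which ties are broken in step `t + 1` may depend on
`ℱ (t + 1)`: on all that has happened so far, on the choices of this step, and on further
randomness. -/
structure IsExecution {V : Type*} [Fintype V] (G : SimpleGraph V) [DecidableRel G.Adj] (s : V)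
    {Ω : Type*} [mΩ : MeasurableSpace Ω] (μ : Measure Ω) (ℱ : Filtration ℕ mΩ)
    (choice : ℕ → Ω → V → V) (conf : ℕ → Ω → Config V) : Prop where
  conf_adapted : ∀ (t : ℕ) (A : Set (Config V)), MeasurableSet[ℱ t] (conf t ⁻¹' A)
  choice_adapted : ∀ (t : ℕ) (A : Set (V → V)), MeasurableSet[ℱ (t + 1)] (choice t ⁻¹' A)
  choice_law : ∀ (t : ℕ) (A : Set Ω), MeasurableSet[ℱ t] A →
    ∀ c : V → V, (∀ v, G.Adj v (c v)) →
      μ (A ∩ {ω | choice t ω = c}) = μ A * ∏ v, ((G.degree v : ℝ≥0∞))⁻¹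
  init : ∀ ω, conf 0 ω = Config.initial s
  step : ∀ t ω, Step (conf t ω) (choice t ω) (conf (t + 1) ω)

/-- The first step at the end of which every node is informed (`∞` if there is none). -/
noncomputable def spreadingTime {V Ω : Type*} (conf : ℕ → Ω → Config V) (ω : Ω) : ℝ≥0∞ :=
  ⨅ (t : ℕ) (_ : (conf t ω).informed = Set.univ), (t : ℝ≥0∞)

end BufferPull

/-! Call a node reached once a copy of the rumor has been sent to it. To cross an edge from a
reached node `u` to `z`, the rumor waits until `z` selects `u` (the `gap`, dominated by a geometric
time with mean `Δ`) and then until `u` has worked through the buffer ahead of this request. The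
buffer holds requests and copies of the rumor. The requests are dominated by `load`, the queue in
which all nodes, informed or not, keep selecting. By regularity its arrivals have mean exactly one,
so it is a critical queue and its size after `t` steps is of order `√t`. Only requests are ahead of
the first copy, so a reached node is informed within about its load. The copies of the rumor are the
real difficulty.

Let `Λ ≥ D (log₂ Δ + 1)`, so that there are at most `2 ^ Λ` nodes. It suffices that some node is
uninformed after a constant times `D Δ Λ` steps with probability at most `2 ^ (-Λ)`
(`measure_late_le`). Taking `Λ` to be multiples of `D (log₂ Δ + 1)` yields a geometric tail for the
spreading time. No restart is involved, since the buffers are never emptied.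

If `Δ ≤ D`, follow a geodesic from `s` to `v`. During a gap a node receives at most `Δ` copies per
step, so the hops cost about `Δ` times the sum of the gaps, plus the loads met on the way. The gaps
sum to `O(Δ Λ)`, which costs `O(Δ² Λ)`, and this is `O(D Δ Λ)`. The loads are read at different
random times, so they are halted there and bounded jointly (`measure_sum_frozen_le`).

If `D ≤ Δ`, then within the horizon all loads are at most some `O` of order `Δ Λ`, and every hop
takes at most `200 O` steps (`reachTime_le_of_adj`). A slower hop means a long buffer at `u`, which
must consist mainly of copies of the rumor. Each of them answers a request of `u` to a reached node,
and `u` sends one request per step, so some neighbor of `u` was reached much earlier than `u`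
(`exists_early_neighbor`). The hop from that neighbor to `u` was therefore nearly as slow. Iterating
gives a path of more than `5 D` slow hops, which does not fit into `500 D O` steps.

All probability bounds are exponential moments propagated by `lintegral_le_pow`, from one-step means
over independent uniform choices. -/

namespace BufferPull

/-! ### Reached nodes, message counts and deterministic runs -/

variable {V : Type*}

/-- A copy of the rumor has been sent to `v`, or `v` has been informed from the beginning. -/
def Config.Reached (σ : Config V) (v : V) : Prop :=
  v ∈ σ.informed ∨ Msg.rumor ∈ σ.buffer v ∨ ∃ w, σ.answer w = some v

section counts
open Classical

/-- The number of nodes that select `v`, whether they are informed or not. -/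
noncomputable def selections [Fintype V] (c : V → V) (v : V) : ℕ :=
  (Finset.univ.filter fun u => c u = v).card

/-- The number of requests that are delivered to `v`. -/
noncomputable def Config.requests [Fintype V] (σ : Config V) (c : V → V) (v : V) : ℕ :=
  (Finset.univ.filter fun u => u ∉ σ.informed ∧ c u = v).card

/-- The number of copies of the rumor on their way to `v`. -/
noncomputable def Config.answers [Fintype V] (σ : Config V) (v : V) : ℕ :=
  (Finset.univ.filter fun w => σ.answer w = some v).card

/-- `1` if `u` sends a request to a node that has been reached, and `0` otherwise. -/
noncomputable def Config.useful (σ : Config V) (c : V → V) (u : V) : ℕ :=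
  if u ∉ σ.informed ∧ σ.Reached (c u) then 1 else 0

/-- The requests of `u` in the buffer of `w` that will be answered. -/
noncomputable def Config.live (σ : Config V) (u w : V) : ℕ :=
  (if w ∈ σ.informed then σ.buffer w
    else (σ.buffer w).dropWhile (fun m => decide (m ≠ Msg.rumor))).count (Msg.request u)

end counts

/-- The length of a queue with arrivals `a` in which one item is served in each step. -/
def backlog (a : ℕ → ℕ) : ℕ → ℕ
  | 0 => 0
  | t + 1 => backlog a t + a t - 1

lemma backlog_mono {a b : ℕ → ℕ} (h : ∀ t, a t ≤ b t) (t : ℕ) : backlog a t ≤ backlog b t := by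
  induction t with
  | zero => simp [backlog]
  | succ t ih => have := h t; simp only [backlog]; omega

lemma Config.requests_le [Fintype V] (σ : Config V) (c : V → V) (v : V) :
    σ.requests c v ≤ selections c v := by
  classical
  exact Finset.card_le_card fun u => by simp +contextual

/-- A deterministic execution, with `queue t v` the messages from which `v` reads in step
`t + 1`. -/
structure IsRun [Fintype V] (G : SimpleGraph V) (s : V) (choice : ℕ → V → V)
    (conf : ℕ → Config V) (queue : ℕ → V → List (Msg V)) : Prop where
  init : conf 0 = Config.initial s
  adj : ∀ t v, G.Adj v (choice t v)
  queue_eq : ∀ t v, ∃ new : List (Msg V), queue t v = (conf t).buffer v ++ new ∧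
    (new : Multiset (Msg V)) = (conf t).arrivals (choice t) v
  conf_succ : ∀ t, conf (t + 1) = (conf t).read (queue t)

lemma exists_isRun [Fintype V] {G : SimpleGraph V} {s : V} {choice : ℕ → V → V}
    {conf : ℕ → Config V} (init : conf 0 = Config.initial s) (adj : ∀ t v, G.Adj v (choice t v))
    (step : ∀ t, Step (conf t) (choice t) (conf (t + 1))) :
    ∃ queue, IsRun G s choice conf queue := by
  choose new h1 h2 using step
  exact ⟨fun t v => (conf t).buffer v ++ new t v, init, adj, fun t v => ⟨new t v, rfl, h1 t v⟩, h2⟩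

/-! ### First-in-first-out dynamics along one run -/

namespace IsRun
variable [Fintype V] {G : SimpleGraph V} {s : V} {choice : ℕ → V → V}
    {conf : ℕ → Config V} {queue : ℕ → V → List (Msg V)}

lemma buffer_succ (h : IsRun G s choice conf queue) (t : ℕ) (v : V) :
    (conf (t + 1)).buffer v = (queue t v).tail := by
  rw [h.conf_succ]; rfl

lemma mem_informed_succ (h : IsRun G s choice conf queue) (t : ℕ) (v : V) :
    v ∈ (conf (t + 1)).informed ↔
      v ∈ (conf t).informed ∨ (queue t v).head? = some Msg.rumor := by
  rw [h.conf_succ]; rfl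

lemma answer_succ (h : IsRun G s choice conf queue) (t : ℕ) (v u : V) :
    (conf (t + 1)).answer v = some u ↔
      v ∈ (conf t).informed ∧ (queue t v).head? = some (Msg.request u) := by
  rw [h.conf_succ]
  simp only [Config.read]
  by_cases hv : v ∈ (conf t).informed
  · simp only [hv, if_true, true_and]
    rcases (queue t v).head? with _ | m
    · simp
    · cases m <;> simp
  · simp [hv]

lemma rumor_mem_arrivals (σ : Config V) (c : V → V) (v : V) :
    Msg.rumor ∈ σ.arrivals c v ↔ ∃ w, σ.answer w = some v := by
  classical
  simp [Config.arrivals, Multiset.mem_replicate, Finset.filter_eq_empty_iff]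

lemma request_mem_arrivals (σ : Config V) (c : V → V) (u v : V) :
    Msg.request u ∈ σ.arrivals c v ↔ u ∉ σ.informed ∧ c u = v := by
  classical
  simp [Config.arrivals, Multiset.mem_replicate]

lemma count_request_arrivals [DecidableEq (Msg V)] (σ : Config V) (c : V → V) (u v : V) :
    (σ.arrivals c v).count (Msg.request u) ≤ 1 := by
  classical
  unfold Config.arrivals
  rw [Multiset.count_add, Multiset.count_replicate]
  simp only [reduceCtorEq, if_false, add_zero]
  refine Multiset.nodup_iff_count_le_one.1 (Multiset.Nodup.map ?_ (Finset.nodup _)) _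
  intro a b; simp

lemma card_arrivals (σ : Config V) (c : V → V) (v : V) :
    (σ.arrivals c v).card = σ.requests c v + σ.answers v := by
  classical
  simp only [Config.arrivals, Multiset.card_add, Multiset.card_map, Multiset.card_replicate,
    Config.requests, Config.answers]
  rfl

lemma length_queue (h : IsRun G s choice conf queue) (t : ℕ) (v : V) :
    (queue t v).length = ((conf t).buffer v).length + ((conf t).requests (choice t) v
      + (conf t).answers v) := by
  obtain ⟨new, h1, h2⟩ := h.queue_eq t v
  rw [h1, List.length_append, ← card_arrivals, ← h2, Multiset.coe_card]

lemma rumor_mem_queue (h : IsRun G s choice conf queue) (t : ℕ) (v : V) :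
    Msg.rumor ∈ queue t v ↔ Msg.rumor ∈ (conf t).buffer v ∨ ∃ w, (conf t).answer w = some v := by
  obtain ⟨new, h1, h2⟩ := h.queue_eq t v
  rw [h1, List.mem_append, ← rumor_mem_arrivals _ (choice t), ← h2, Multiset.mem_coe]

lemma informed_mono (h : IsRun G s choice conf queue) {t t' : ℕ} (htt : t ≤ t') :
    (conf t).informed ⊆ (conf t').informed := by
  induction htt with
  | refl => exact subset_rfl
  | step _ ih => exact fun v hv => (h.mem_informed_succ _ v).2 (Or.inl (ih hv))

/-- The number of messages in a buffer is at most the backlog caused by the requests plus the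
number of copies of the rumor that have been delivered. -/
lemma length_buffer_le (h : IsRun G s choice conf queue) (v : V) (t : ℕ) :
    ((conf t).buffer v).length ≤
      backlog (fun τ => (conf τ).requests (choice τ) v) t
        + ∑ τ ∈ Finset.range t, (conf τ).answers v := by
  induction t with
  | zero => simp [h.init, Config.initial]
  | succ t ih =>
    have := h.length_queue t v
    rw [h.buffer_succ, List.length_tail, Finset.sum_range_succ, backlog]
    omega

/-- First in, first out. -/
lemma head_queue (h : IsRun G s choice conf queue) (v : V) (p : ℕ) : ∀ (t : ℕ) (m : Msg V),
    (queue t v)[p]? = some m → (queue (t + p) v).head? = some m := by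
  induction p with
  | zero => intro t m hm; simpa [List.head?_eq_getElem?] using hm
  | succ p ih =>
    intro t m hm
    have : (queue (t + 1) v)[p]? = some m := by
      obtain ⟨new, h1, -⟩ := h.queue_eq (t + 1) v
      rw [h1, h.buffer_succ]
      have h3 : (queue t v).tail[p]? = some m := by rw [List.getElem?_tail]; exact hm
      rw [List.getElem?_append_left, h3]
      by_contra hlt
      rw [List.getElem?_eq_none (by omega)] at h3
      simp at h3
    have := ih (t + 1) m this
    rwa [show t + (p + 1) = t + 1 + p by ring]

lemma informed_of_getElem (h : IsRun G s choice conf queue) {v : V} {t p : ℕ}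
    (hp : (queue t v)[p]? = some Msg.rumor) : v ∈ (conf (t + p + 1)).informed :=
  (h.mem_informed_succ _ v).2 (Or.inr (h.head_queue v p t _ hp))

lemma informed_of_mem_take (h : IsRun G s choice conf queue) {v : V} {t p : ℕ}
    (hp : Msg.rumor ∈ (queue t v).take p) : v ∈ (conf (t + p)).informed := by
  obtain ⟨i, hi, hm⟩ := List.mem_iff_getElem.1 hp
  have hi' : i < p ∧ i < (queue t v).length := by simpa using hi
  refine h.informed_mono (t := t + i + 1) (by omega) (h.informed_of_getElem ?_)
  rw [List.getElem_take] at hm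
  rw [List.getElem?_eq_getElem hi'.2, hm]

lemma reached_succ (h : IsRun G s choice conf queue) {t : ℕ} {v : V}
    (hr : (conf t).Reached v) :
    v ∈ (conf (t + 1)).informed ∨ Msg.rumor ∈ (conf (t + 1)).buffer v := by
  by_cases hi : v ∈ (conf t).informed
  · exact Or.inl ((h.mem_informed_succ t v).2 (Or.inl hi))
  have hq : Msg.rumor ∈ queue t v := by
    rw [h.rumor_mem_queue]
    rcases hr with hr | hr | hr
    · exact absurd hr hi
    · exact Or.inl hr
    · exact Or.inr hr
  rw [h.buffer_succ]
  cases hl : queue t v with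
  | nil => simp [hl] at hq
  | cons m l =>
    rw [hl] at hq
    rcases List.mem_cons.1 hq with hm | hm
    · exact Or.inl ((h.mem_informed_succ t v).2 (Or.inr (by simp [hl, hm])))
    · exact Or.inr hm

lemma reached_mono (h : IsRun G s choice conf queue) {v : V} {t t' : ℕ} (htt : t ≤ t')
    (hr : (conf t).Reached v) : (conf t').Reached v := by
  induction htt with
  | refl => exact hr
  | step _ ih =>
    rcases h.reached_succ ih with h1 | h1
    · exact Or.inl h1
    · exact Or.inr (Or.inl h1)

lemma reached_zero (h : IsRun G s choice conf queue) (v : V) : (conf 0).Reached v ↔ v = s := by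
  simp [Config.Reached, h.init, Config.initial]

/-- A request that arrives after the rumor is answered as soon as it is read. -/
lemma reached_of_request (h : IsRun G s choice conf queue) {u z : V} {τ g : ℕ}
    (hτ : τ < g) (hr : (conf τ).Reached u) (hc : choice g z = u) :
    (conf (g + 1 + ((conf (g + 1)).buffer u).length)).Reached z := by
  by_cases hz : z ∈ (conf g).informed
  · exact h.reached_mono (by omega) (Or.inl hz)
  obtain ⟨new, h1, h2⟩ := h.queue_eq g u
  have hm : Msg.request z ∈ new := by
    rw [← Multiset.mem_coe, h2, request_mem_arrivals]; exact ⟨hz, hc⟩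
  obtain ⟨i, hi, hnew⟩ := List.mem_iff_getElem.1 hm
  have hq : (queue g u)[((conf g).buffer u).length + i]? = some (Msg.request z) := by
    rw [h1, List.getElem?_append_right (by omega), Nat.add_sub_cancel_left,
      List.getElem?_eq_getElem hi, hnew]
  set p := ((conf g).buffer u).length + i with hp
  have hlen : p < (queue g u).length := by
    by_contra hlt
    rw [List.getElem?_eq_none (by omega)] at hq; simp at hq
  -- Since `τ < g`, at the end of step `g` either `u` is informed or the rumor is already in its
  -- buffer, ahead of all arrivals of the next step. For `τ = g` the tie-breaking could put the
  -- request first, and it would be lost.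
  have hinf : u ∈ (conf (g + p)).informed := by
    rcases h.reached_succ (h.reached_mono (Nat.le_sub_one_of_lt hτ) hr) with h3 | h3
    · rw [Nat.sub_add_cancel (by omega)] at h3
      exact h.informed_mono (by omega) h3
    · rw [Nat.sub_add_cancel (by omega)] at h3
      apply h.informed_of_mem_take
      rw [h1, hp, List.take_append]
      rw [List.take_of_length_le (by omega)]
      exact List.mem_append_left _ h3
  have ha : (conf (g + p + 1)).answer u = some z :=
    (h.answer_succ _ _ _).2 ⟨hinf, h.head_queue u p g _ hq⟩
  refine h.reached_mono (t := g + p + 1) ?_ (Or.inr (Or.inr ⟨u, ha⟩))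
  rw [h.buffer_succ, List.length_tail]
  omega

end IsRun

/-! ### Delay of the first copy, and counting the copies sent to a node -/

namespace IsRun
variable [Fintype V] {G : SimpleGraph V} {s : V} {choice : ℕ → V → V}
    {conf : ℕ → Config V} {queue : ℕ → V → List (Msg V)}

/-- A node is informed soon after it has been reached: only requests are ahead of the first copy
of the rumor. -/
lemma informed_of_first_reached (h : IsRun G s choice conf queue) {v : V} {t : ℕ}
    (hr : (conf t).Reached v) (hfirst : ∀ τ < t, ¬ (conf τ).Reached v) :
    v ∈ (conf (t + 2 + backlog (fun τ => selections (choice τ) v) (t + 1))).informed := by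
  by_cases hi : v ∈ (conf t).informed
  · exact h.informed_mono (by omega) hi
  have hnone : ∀ τ < t, (conf τ).answers v = 0 := by
    intro τ hτ
    have := hfirst τ hτ
    simp only [Config.Reached, not_or, not_exists] at this
    simp only [Config.answers, Finset.card_eq_zero, Finset.filter_eq_empty_iff]
    exact fun w _ => this.2.2 w
  have hnr : Msg.rumor ∉ (conf t).buffer v := by
    intro hm
    cases t with
    | zero => simp [h.init, Config.initial] at hm
    | succ t =>
      rw [h.buffer_succ] at hm
      have := (h.rumor_mem_queue t v).1 (List.mem_of_mem_tail hm)
      exact hfirst t (by omega) (by unfold Config.Reached; tauto)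
  have hlen := h.length_buffer_le v t
  rw [Finset.sum_eq_zero (fun τ hτ => hnone τ (Finset.mem_range.1 hτ)), add_zero] at hlen
  have hq : Msg.rumor ∈ queue t v := by
    rw [h.rumor_mem_queue]
    rcases hr with hr | hr | hr
    · exact absurd hr hi
    · exact Or.inl hr
    · exact Or.inr hr
  classical
  obtain ⟨new, h1, h2⟩ := h.queue_eq t v
  -- the first copy of the rumor has only requests of the last step ahead in `new`
  have hnew : Msg.rumor ∈ new := by
    rw [h1, List.mem_append] at hq; tauto
  have hidx : new.idxOf Msg.rumor ≤ (conf t).requests (choice t) v := by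
    have hsub : new.idxOf Msg.rumor ≤ new.countP (fun m => m ≠ Msg.rumor) := by
      clear h1 h2 hq hlen
      induction new with
      | nil => simp
      | cons m l ih =>
        by_cases hm : m = Msg.rumor
        · simp [hm]
        · rw [List.idxOf_cons_ne _ hm, List.countP_cons_of_pos (by simpa using hm)]
          have := ih (by simpa [Ne.symm hm] using hnew)
          omega
    refine hsub.trans ?_
    have : new.countP (fun m => m ≠ Msg.rumor) =
        (Multiset.countP (fun m => m ≠ Msg.rumor) (new : Multiset (Msg V))) := by
      simp
    rw [this, h2, Config.arrivals, Multiset.countP_add]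
    have h0 : Multiset.countP (fun m : Msg V => m ≠ Msg.rumor)
        (Multiset.replicate (Finset.univ.filter fun w => (conf t).answer w = some v).card
          Msg.rumor) = 0 := by
      rw [Multiset.countP_eq_zero]
      intro m hm; simp [Multiset.eq_of_mem_replicate hm]
    rw [h0, add_zero]
    refine (Multiset.countP_le_card _ _).trans ?_
    rw [Multiset.card_map]
    exact le_of_eq (by unfold Config.requests; congr)
  have hread := h.informed_of_getElem (v := v) (t := t)
    (p := ((conf t).buffer v).length + new.idxOf Msg.rumor) (by
      rw [h1, List.getElem?_append_right (by omega), Nat.add_sub_cancel_left,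
        List.getElem?_eq_getElem (List.idxOf_lt_length_of_mem hnew), List.getElem_idxOf])
  refine h.informed_mono ?_ hread
  have hb := backlog_mono (fun τ => (conf τ).requests_le (choice τ) v) t
  have hr := (conf t).requests_le (choice t) v
  -- The position of the rumor is at most `backlog t + selections t`, which exceeds `backlog (t +
  -- 1)` by at most one. Reading takes one more step, whence the `2`.
  simp only [backlog]
  omega

lemma informed_of_reached (h : IsRun G s choice conf queue) {v : V} {t b : ℕ}
    (hb : ∀ τ ≤ t + 1, backlog (fun τ => selections (choice τ) v) τ ≤ b)
    (hr : (conf t).Reached v) : v ∈ (conf (t + 2 + b)).informed := by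
  classical
  have hex : ∃ τ, (conf τ).Reached v := ⟨t, hr⟩
  have hle : Nat.find hex ≤ t := Nat.find_min' hex hr
  refine h.informed_mono ?_ (h.informed_of_first_reached (Nat.find_spec hex)
    fun τ hτ => Nat.find_min hex hτ)
  have := hb (Nat.find hex + 1) (by omega)
  omega

-- A potential argument for one ordered pair. Only a request that arrives at `w` once `w` has been
-- reached can stand behind a copy of the rumor and become live. An answer consumes one live
-- request, so answers already given plus live requests never exceed the useful requests sent.
open Classical in
lemma answers_add_live_le (h : IsRun G s choice conf queue) (u w : V) (t : ℕ) :
    ∑ τ ∈ Finset.range (t + 1), (if (conf τ).answer w = some u then 1 else 0)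
      + (conf t).live u w ≤
    ∑ τ ∈ Finset.range t, if choice τ u = w then (conf τ).useful (choice τ) u else 0 := by
  induction t with
  | zero => simp [h.init, Config.initial, Config.live]
  | succ t ih =>
    rw [Finset.sum_range_succ, Finset.sum_range_succ (fun τ =>
      if choice τ u = w then (conf τ).useful (choice τ) u else 0) t]
    suffices hs : (if (conf (t + 1)).answer w = some u then 1 else 0) + (conf (t + 1)).live u w ≤
        (conf t).live u w + if choice t u = w then (conf t).useful (choice t) u else 0 by omega
    obtain ⟨new, h1, h2⟩ := h.queue_eq t w
    have hcount : (conf t).Reached w →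
        new.count (Msg.request u) ≤
          if choice t u = w then (conf t).useful (choice t) u else 0 := by
      intro hr
      rw [← Multiset.coe_count, h2]
      by_cases hu : Msg.request u ∈ (conf t).arrivals (choice t) w
      · have := (request_mem_arrivals _ _ _ _).1 hu
        rw [if_pos this.2, Config.useful, if_pos ⟨this.1, this.2 ▸ hr⟩]
        exact count_request_arrivals _ _ _ _
      · rw [Multiset.count_eq_zero_of_notMem hu]; exact Nat.zero_le _
    unfold Config.live
    rw [h.buffer_succ]
    simp only [h.answer_succ, h.mem_informed_succ]
    by_cases hi : w ∈ (conf t).informed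
    · simp only [hi, true_or, true_and, if_true]
      have h3 := hcount (Or.inl hi)
      have h4 : (queue t w).count (Msg.request u) =
        ((conf t).buffer w).count (Msg.request u) + new.count (Msg.request u) := by
        rw [h1, List.count_append]
      have h5 : (if (queue t w).head? = some (Msg.request u) then 1 else 0)
          + (queue t w).tail.count (Msg.request u) = (queue t w).count (Msg.request u) := by
        cases queue t w with
        | nil => simp
        | cons m l => simp [List.count_cons, add_comm]
      omega
    · simp only [hi, false_or, false_and, if_false, zero_add]
      set f : Msg V → Bool := fun m => decide (m ≠ Msg.rumor) with hf
      -- Reading changes no live request while `w` is uninformed: a head other than the rumor is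
      -- skipped by `dropWhile` anyway, and when the rumor is read everything behind it stays live.
      have h5 : (if (queue t w).head? = some Msg.rumor then (queue t w).tail
          else (queue t w).tail.dropWhile f).count (Msg.request u) =
          ((queue t w).dropWhile f).count (Msg.request u) := by
        cases queue t w with
        | nil => simp
        | cons m l =>
          by_cases hm : m = Msg.rumor
          · simp [hm, hf]
          · simp [hm, hf]
      rw [h5]
      by_cases hr : Msg.rumor ∈ queue t w
      · have hreach : (conf t).Reached w := by
          have := (h.rumor_mem_queue t w).1 hr
          unfold Config.Reached; tauto
        have h3 := hcount hreach
        have h4 : ((queue t w).dropWhile f).count (Msg.request u) ≤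
            (((conf t).buffer w).dropWhile f).count (Msg.request u)
              + new.count (Msg.request u) := by
          rw [h1, List.dropWhile_append]
          split_ifs with he
          · exact ((List.dropWhile_sublist _).count_le _).trans (Nat.le_add_left _ _)
          · rw [List.count_append]
        omega
      · have : (queue t w).dropWhile f = [] := by
          rw [List.dropWhile_eq_nil_iff]
          intro m hm
          simp only [hf, decide_eq_true_eq]
          rintro rfl; exact hr hm
        rw [this]; simp

/-- Every copy of the rumor for `u` answers a request that `u` sent to a node that had been
reached. -/
lemma sum_answers_le (h : IsRun G s choice conf queue) (u : V) (t : ℕ) :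
    ∑ τ ∈ Finset.range t, (conf τ).answers u ≤
      ∑ τ ∈ Finset.range t, (conf τ).useful (choice τ) u := by
  classical
  have h1 : ∀ τ, (conf τ).answers u = ∑ w, if (conf τ).answer w = some u then 1 else 0 := by
    intro τ
    rw [Config.answers, Finset.card_filter]
  have h2 : ∀ τ, (conf τ).useful (choice τ) u =
      ∑ w, if choice τ u = w then (conf τ).useful (choice τ) u else 0 := by
    intro τ
    rw [Finset.sum_ite_eq]; simp
  simp_rw [h1]
  rw [Finset.sum_congr rfl fun τ _ => h2 τ, Finset.sum_comm, Finset.sum_comm (s := Finset.range t)]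
  refine Finset.sum_le_sum fun w _ => ?_
  have := h.answers_add_live_le u w t
  rw [Finset.sum_range_succ] at this
  omega

/-- Requests travel along edges, hence so do answers. This limits the copies sent to a node in one
step to its degree. -/
lemma adj_of_request_mem_buffer (h : IsRun G s choice conf queue) {u w : V} (t : ℕ) :
    (Msg.request u ∈ (conf t).buffer w → G.Adj u w) ∧
      ((conf t).answer w = some u → G.Adj u w) := by
  have key : ∀ t, (Msg.request u ∈ (conf t).buffer w → G.Adj u w) →
      Msg.request u ∈ queue t w → G.Adj u w := by
    intro t hb hq
    obtain ⟨new, h1, h2⟩ := h.queue_eq t w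
    rw [h1, List.mem_append] at hq
    rcases hq with hq | hq
    · exact hb hq
    · rw [← Multiset.mem_coe, h2, request_mem_arrivals] at hq
      exact hq.2 ▸ h.adj t u
  induction t with
  | zero => simp [h.init, Config.initial]
  | succ t ih =>
    refine ⟨fun hm => key t ih.1 (List.mem_of_mem_tail (h.buffer_succ t w ▸ hm)), fun ha => ?_⟩
    exact key t ih.1 (List.mem_of_mem_head? ((h.answer_succ t w u).1 ha).2)

lemma answers_le_degree [DecidableRel G.Adj] (h : IsRun G s choice conf queue) (t : ℕ) (u : V) :
    (conf t).answers u ≤ G.degree u := by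
  classical
  refine Finset.card_le_card fun w hw => ?_
  rw [SimpleGraph.mem_neighborFinset]
  exact (h.adj_of_request_mem_buffer t).2 (Finset.mem_filter.1 hw).2

end IsRun

/-! ### Reach times and gaps, truncated at a horizon -/

section times
open Classical

/-- The number of steps among the first `N` before `v` is reached. -/
noncomputable def reachTime (conf : ℕ → Config V) (N : ℕ) (v : V) : ℕ :=
  ((Finset.range N).filter fun τ => ¬ (conf τ).Reached v).card

/-- `w` had been reached before the step with number `t`. -/
def Armed (conf : ℕ → Config V) (w : V) (t : ℕ) : Prop := ∃ τ < t, (conf τ).Reached w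

/-- In one of the first `t` steps `u` has selected `w`, which had been reached before. -/
def Hit (conf : ℕ → Config V) (choice : ℕ → V → V) (u w : V) (t : ℕ) : Prop :=
  ∃ τ < t, Armed conf w τ ∧ choice τ u = w

/-- The time, among the first `t` steps, that passes from `w` being reached until `u`
selects `w`. -/
noncomputable def gap (conf : ℕ → Config V) (choice : ℕ → V → V) (u w : V) (t : ℕ) : ℕ :=
  ((Finset.range t).filter fun τ => Armed conf w τ ∧ ¬ Hit conf choice u w τ).card

end times

lemma reachTime_le (conf : ℕ → Config V) (N : ℕ) (v : V) : reachTime conf N v ≤ N := by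
  classical
  exact (Finset.card_filter_le _ _).trans (by simp)

namespace IsRun
variable [Fintype V] {G : SimpleGraph V} {s : V} {choice : ℕ → V → V}
    {conf : ℕ → Config V} {queue : ℕ → V → List (Msg V)}

lemma reachTime_le_of_reached (h : IsRun G s choice conf queue) {N t : ℕ} {v : V}
    (hr : (conf t).Reached v) : reachTime conf N v ≤ t := by
  classical
  calc _ ≤ (Finset.range t).card := Finset.card_le_card fun τ hτ => by
        rw [Finset.mem_filter] at hτ
        rw [Finset.mem_range]
        by_contra hlt
        exact hτ.2 (h.reached_mono (by omega) hr)
    _ = t := Finset.card_range t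

lemma reached_reachTime (h : IsRun G s choice conf queue) {N : ℕ} {v : V}
    (hN : reachTime conf N v < N) : (conf (reachTime conf N v)).Reached v := by
  classical
  by_contra hr
  have : (Finset.range (reachTime conf N v + 1)).card ≤ reachTime conf N v := by
    refine Finset.card_le_card fun τ hτ => ?_
    rw [Finset.mem_range] at hτ
    rw [Finset.mem_filter, Finset.mem_range]
    exact ⟨by omega, fun h' => hr (h.reached_mono (by omega) h')⟩
  simp at this

lemma reachTime_source (h : IsRun G s choice conf queue) (N : ℕ) : reachTime conf N s = 0 :=
  Nat.le_zero.1 (h.reachTime_le_of_reached ((h.reached_zero s).2 rfl))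

/-- Within the horizon, `u` selects `w` exactly `gap` steps after `w` was reached. -/
lemma choice_gap (h : IsRun G s choice conf queue) {N : ℕ} {u w : V}
    (hN : reachTime conf N w + gap conf choice u w N + 1 < N) :
    0 < gap conf choice u w N ∧
      choice (reachTime conf N w + gap conf choice u w N) u = w ∧
      ∀ t ≤ reachTime conf N w + gap conf choice u w N, ¬ Hit conf choice u w t := by
  classical
  set S := reachTime conf N w with hS
  have hreach : (conf S).Reached w := h.reached_reachTime (by omega)
  have harmed : ∀ τ ≤ N, Armed conf w τ ↔ S < τ := by
    intro τ hτ
    constructor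
    · rintro ⟨τ', h1, h2⟩
      exact lt_of_le_of_lt (h.reachTime_le_of_reached h2) h1
    · exact fun hlt => ⟨S, hlt, hreach⟩
  -- Otherwise each of the steps `S + 1, …, N - 1` counts towards the gap, against `hN`.
  have hhit : Hit conf choice u w N := by
    by_contra hno
    have : (Finset.Ico (S + 1) N).card ≤ gap conf choice u w N := by
      refine Finset.card_le_card fun τ hτ => ?_
      rw [Finset.mem_Ico] at hτ
      rw [Finset.mem_filter, Finset.mem_range]
      refine ⟨hτ.2, (harmed τ (by omega)).2 (by omega), fun ⟨τ', h1, h2⟩ => hno ⟨τ', by omega, h2⟩⟩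
    rw [Nat.card_Ico] at this
    omega
  have hex : ∃ τ, τ < N ∧ Armed conf w τ ∧ choice τ u = w := hhit
  set σ := Nat.find hex with hσ
  obtain ⟨h1, h2, h3⟩ := Nat.find_spec hex
  rw [← hσ] at h1 h2 h3
  have hfirst : ∀ t ≤ σ, ¬ Hit conf choice u w t := by
    rintro t ht ⟨τ, hτ, h4⟩
    exact Nat.find_min hex (m := τ) (by omega) ⟨by omega, h4⟩
  have hgap : gap conf choice u w N = σ - S := by
    have : gap conf choice u w N = (Finset.Ioc S σ).card := by
      unfold gap
      congr 1
      ext τ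
      rw [Finset.mem_filter, Finset.mem_range, Finset.mem_Ioc]
      constructor
      · rintro ⟨h4, h5, h6⟩
        refine ⟨(harmed τ h4.le).1 h5, ?_⟩
        by_contra hlt
        exact h6 ⟨σ, by omega, h2, h3⟩
      · rintro ⟨h4, h5⟩
        exact ⟨by omega, (harmed τ (by omega)).2 h4, hfirst τ h5⟩
    rw [this, Nat.card_Ioc]
  have hlt := (harmed σ h1.le).1 h2
  have hsum : S + gap conf choice u w N = σ := by omega
  rw [hsum]
  exact ⟨by omega, h3, hfirst⟩

/-- The time that a hop takes. -/
lemma reachTime_le_hop (h : IsRun G s choice conf queue) (N : ℕ) (z u : V) :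
    let t := reachTime conf N u + gap conf choice z u N + 1
    N ≤ t ∨ reachTime conf N z ≤ t + ((conf t).buffer u).length := by
  intro t
  by_cases hN : N ≤ t
  · exact Or.inl hN
  obtain ⟨h1, h2, -⟩ := h.choice_gap (u := z) (w := u) (N := N) (by omega)
  refine Or.inr (h.reachTime_le_of_reached ?_)
  exact h.reached_of_request (τ := reachTime conf N u) (by omega)
    (h.reached_reachTime (by omega)) h2

end IsRun

/-! ### Averages over the choices of one step -/

section mean
open Classical

/-- The mean of `g c` over a choice `c` of independent uniformly distributed neighbors. -/
noncomputable def choiceMean [Fintype V] (G : SimpleGraph V) [DecidableRel G.Adj]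
    (g : (V → V) → ℝ≥0∞) : ℝ≥0∞ :=
  ∑ c ∈ Fintype.piFinset fun v => G.neighborFinset v, g c * ∏ v, (G.degree v : ℝ≥0∞)⁻¹

lemma choiceMean_mono [Fintype V] (G : SimpleGraph V) [DecidableRel G.Adj]
    {f g : (V → V) → ℝ≥0∞} (h : ∀ c, (∀ v, G.Adj v (c v)) → f c ≤ g c) :
    choiceMean G f ≤ choiceMean G g := by
  refine Finset.sum_le_sum fun c hc => mul_le_mul_left (h c fun v => ?_) _
  rw [Fintype.mem_piFinset] at hc
  simpa using hc v

lemma choiceMean_prod [Fintype V] (G : SimpleGraph V) [DecidableRel G.Adj]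
    (f : V → V → ℝ≥0∞) :
    choiceMean G (fun c => ∏ v, f v (c v)) =
      ∏ v, ((∑ w ∈ G.neighborFinset v, f v w) * (G.degree v : ℝ≥0∞)⁻¹) := by
  rw [Finset.prod_mul_distrib, Finset.prod_univ_sum, Finset.sum_mul]
  rfl

lemma choiceMean_const_mul [Fintype V] (G : SimpleGraph V) [DecidableRel G.Adj]
    (a : ℝ≥0∞) (g : (V → V) → ℝ≥0∞) :
    choiceMean G (fun c => a * g c) = a * choiceMean G g := by
  simp only [choiceMean, Finset.mul_sum, mul_assoc]

lemma choiceMean_sum [Fintype V] (G : SimpleGraph V) [DecidableRel G.Adj] {ι : Type*}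
    (J : Finset ι) (g : ι → (V → V) → ℝ≥0∞) :
    choiceMean G (fun c => ∑ j ∈ J, g j c) = ∑ j ∈ J, choiceMean G (g j) := by
  simp only [choiceMean, Finset.sum_mul]
  rw [Finset.sum_comm]

lemma choiceMean_const [Fintype V] (G : SimpleGraph V) [DecidableRel G.Adj]
    (hdeg : ∀ v, 0 < G.degree v) (a : ℝ≥0∞) : choiceMean G (fun _ => a) = a := by
  have h := choiceMean_prod G (fun _ _ => 1)
  have h1 : choiceMean G (fun _ => 1) = 1 := by
    simp only [Finset.prod_const_one] at h
    rw [h]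
    refine Finset.prod_eq_one fun v _ => ?_
    rw [Finset.sum_const, nsmul_one, SimpleGraph.card_neighborFinset_eq_degree]
    exact ENNReal.mul_inv_cancel (by exact_mod_cast (hdeg v).ne') (ENNReal.natCast_ne_top _)
  simpa [h1] using choiceMean_const_mul G a (fun _ => 1)

end mean

/-! ### Independence of the choices from the past -/

/-- `Y` is a function of the first `t` steps. -/
def Determined {Ω β : Type*} (choice : ℕ → Ω → V → V) (conf : ℕ → Ω → Config V) (t : ℕ)
    (Y : Ω → β) : Prop :=
  ∀ ω ω', (∀ i ≤ t, conf i ω = conf i ω') → (∀ i < t, choice i ω = choice i ω') → Y ω = Y ω'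

instance [Finite V] : Countable (Msg V) :=
  (Function.Injective.countable (f := fun m : Msg V => match m with
    | Msg.request u => some u
    | Msg.rumor => none) (by rintro (_ | _) (_ | _) <;> simp))

instance [Finite V] : Countable (Config V) :=
  (Function.Injective.countable (f := fun σ : Config V => (σ.informed, σ.buffer, σ.answer)) (by
    rintro ⟨_, _, _⟩ ⟨_, _, _⟩; simp))

namespace IsExecution
variable [Fintype V] {G : SimpleGraph V} [DecidableRel G.Adj] {s : V}
    {Ω : Type*} [mΩ : MeasurableSpace Ω] {μ : Measure Ω} {ℱ : Filtration ℕ mΩ}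
    {choice : ℕ → Ω → V → V} {conf : ℕ → Ω → Config V}

/-- As `V` is finite, there are only countably many histories of length `t`, and each of them is an
event of `ℱ t`. Hence no measurability has to be checked for the quantities studied later. -/
lemma measurableSet_of_determined (h : IsExecution G s μ ℱ choice conf) {t : ℕ} {β : Type*}
    {Y : Ω → β} (hY : Determined choice conf t Y) (A : Set β) : MeasurableSet[ℱ t] (Y ⁻¹' A) := by
  let H : Ω → (Fin (t + 1) → Config V) × (Fin t → V → V) :=
    fun ω => (fun i => conf i ω, fun i => choice i ω)
  have hA : Y ⁻¹' A = ⋃ x ∈ H '' (Y ⁻¹' A), H ⁻¹' {x} := by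
    ext ω
    simp only [Set.mem_iUnion, Set.mem_preimage, Set.mem_singleton_iff, exists_prop]
    constructor
    · exact fun hω => ⟨H ω, ⟨ω, hω, rfl⟩, rfl⟩
    · rintro ⟨_, ⟨ω', hω', rfl⟩, he⟩
      have h1 : Y ω = Y ω' := by
        refine hY ω ω' (fun i hi => ?_) (fun i hi => ?_)
        · exact congrFun (congrArg Prod.fst he) ⟨i, by omega⟩
        · exact congrFun (congrArg Prod.snd he) ⟨i, hi⟩
      simpa [h1] using hω'
  rw [hA]
  refine MeasurableSet.biUnion (Set.to_countable _) fun x _ => ?_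
  have hx : H ⁻¹' {x} = (⋂ i : Fin (t + 1), conf i ⁻¹' {x.1 i}) ∩
      ⋂ i : Fin t, choice i ⁻¹' {x.2 i} := by
    ext ω
    simp only [H, Set.mem_preimage, Set.mem_singleton_iff, Prod.ext_iff, funext_iff,
      Set.mem_inter_iff, Set.mem_iInter]
  rw [hx]
  refine MeasurableSet.inter (MeasurableSet.iInter fun i => ?_) (MeasurableSet.iInter fun i => ?_)
  · exact ℱ.mono (Nat.lt_succ_iff.1 i.2) _ (h.conf_adapted i _)
  · exact ℱ.mono (Nat.succ_le_of_lt i.2) _ (h.choice_adapted i _)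

lemma measurable_of_determined (h : IsExecution G s μ ℱ choice conf) {t : ℕ}
    {Y : Ω → ℝ≥0∞} (hY : Determined choice conf t Y) : Measurable[ℱ t] Y :=
  fun A _ => h.measurableSet_of_determined hY A

lemma measurableSet_choice (h : IsExecution G s μ ℱ choice conf) (t : ℕ) (c : V → V) :
    MeasurableSet {ω | choice t ω = c} := ℱ.le _ _ (h.choice_adapted t {c})

lemma ae_adj [IsProbabilityMeasure μ] (h : IsExecution G s μ ℱ choice conf)
    (hdeg : ∀ v, 0 < G.degree v) :
    ∀ᵐ ω ∂μ, ∀ t v, G.Adj v (choice t ω v) := by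
  classical
  rw [ae_all_iff]
  intro t
  set P := Fintype.piFinset fun v => G.neighborFinset v
  have hS : {ω | ∀ v, G.Adj v (choice t ω v)} = ⋃ c ∈ P, {ω | choice t ω = c} := by
    ext ω; simp [P, Fintype.mem_piFinset]
  have hm : MeasurableSet {ω | ∀ v, G.Adj v (choice t ω v)} := by
    rw [hS]
    exact Finset.measurableSet_biUnion _ fun c _ => h.measurableSet_choice t c
  have h1 : μ {ω | ∀ v, G.Adj v (choice t ω v)} = 1 := by
    rw [hS, measure_biUnion_finset]
    · have := choiceMean_const G hdeg 1
      simp only [choiceMean, one_mul] at this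
      rw [← this]
      refine Finset.sum_congr rfl fun c hc => ?_
      have := h.choice_law t Set.univ MeasurableSet.univ c (by
        intro v; simpa using Fintype.mem_piFinset.1 hc v)
      simpa using this
    · intro c _ c' _ hne
      refine Set.disjoint_left.2 fun ω h1 h2 => hne ?_
      exact h1.symm.trans h2
    · exact fun c _ => h.measurableSet_choice t c
  exact (prob_compl_eq_zero_iff hm).2 h1

/-- The choices of a step are independent of the past. -/
lemma lintegral_choice [IsProbabilityMeasure μ] (h : IsExecution G s μ ℱ choice conf)
    (hdeg : ∀ v, 0 < G.degree v) {t : ℕ} {Ψ : Ω → (V → V) → ℝ≥0∞}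
    (hΨ : ∀ c, Determined choice conf t fun ω => Ψ ω c) :
    ∫⁻ ω, Ψ ω (choice t ω) ∂μ = ∫⁻ ω, choiceMean G (Ψ ω) ∂μ := by
  classical
  set P := Fintype.piFinset fun v => G.neighborFinset v with hP
  have hmeas : ∀ c, Measurable[ℱ t] fun ω => Ψ ω c := fun c =>
    h.measurable_of_determined (hΨ c)
  have hmeas' : ∀ c, Measurable fun ω => Ψ ω c := fun c => (hmeas c).mono (ℱ.le t) le_rfl
  have h1 : ∀ᵐ ω ∂μ, Ψ ω (choice t ω) =
      ∑ c ∈ P, {ω | choice t ω = c}.indicator (fun ω => Ψ ω c) ω := by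
    filter_upwards [h.ae_adj hdeg] with ω hω
    rw [Finset.sum_eq_single (choice t ω)]
    · simp
    · intro c _ hc
      exact Set.indicator_of_notMem (fun he => hc (Eq.symm he)) _
    · intro hc
      exact absurd (by simpa [hP, Fintype.mem_piFinset] using hω t) hc
  rw [lintegral_congr_ae h1, lintegral_finsetSum]
  swap
  · exact fun c _ => (hmeas' c).indicator (h.measurableSet_choice t c)
  have h2 : ∫⁻ ω, choiceMean G (Ψ ω) ∂μ =
      ∑ c ∈ P, ∫⁻ ω, Ψ ω c * ∏ v, (G.degree v : ℝ≥0∞)⁻¹ ∂μ := by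
    unfold choiceMean
    rw [lintegral_finsetSum]
    exact fun c _ => (hmeas' c).mul_const _
  rw [h2]
  refine Finset.sum_congr rfl fun c hc => ?_
  rw [lintegral_indicator (h.measurableSet_choice t c)]
  set p : ℝ≥0∞ := ∏ v, (G.degree v : ℝ≥0∞)⁻¹
  -- Independence as an identity of measures on `ℱ t`: restricting to one outcome of the choices
  -- multiplies `μ` by its probability `p`.
  have htrim : (μ.restrict {ω | choice t ω = c}).trim (ℱ.le t) = (p • μ).trim (ℱ.le t) := by
    refine @Measure.ext _ (ℱ t) _ _ fun A hA => ?_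
    rw [trim_measurableSet_eq _ hA, trim_measurableSet_eq _ hA, Measure.restrict_apply (ℱ.le t _ hA),
      h.choice_law t A hA c (fun v => by simpa using Fintype.mem_piFinset.1 hc v)]
    simp [p, mul_comm]
  rw [← lintegral_trim (ℱ.le t) (hmeas c), htrim, lintegral_trim (ℱ.le t) (hmeas c),
    lintegral_smul_measure, lintegral_mul_const _ (hmeas' c), smul_eq_mul, mul_comm]

/-- The expectation of a process that, conditionally on the past, grows by a factor of at most `κ`
in each step. -/
lemma lintegral_le_pow [IsProbabilityMeasure μ] (h : IsExecution G s μ ℱ choice conf)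
    (hdeg : ∀ v, 0 < G.degree v) {κ : ℝ≥0∞} (hκ : κ ≠ ⊤) (b : ℕ) (Y : ℕ → Ω → ℝ≥0∞)
    (Ψ : ℕ → Ω → (V → V) → ℝ≥0∞)
    (hdet : ∀ t c, Determined choice conf t fun ω => Ψ t ω c)
    (hΨ : ∀ t ω, b ≤ t → (∀ t v, G.Adj v (choice t ω v)) → Y (t + 1) ω ≤ Ψ t ω (choice t ω))
    (hmean : ∀ t ω, b ≤ t → choiceMean G (Ψ t ω) ≤ κ * Y t ω) (k : ℕ) :
    ∫⁻ ω, Y (b + k) ω ∂μ ≤ κ ^ k * ∫⁻ ω, Y b ω ∂μ := by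
  induction k with
  | zero => simp
  | succ k ih =>
    calc ∫⁻ ω, Y (b + (k + 1)) ω ∂μ ≤ ∫⁻ ω, Ψ (b + k) ω (choice (b + k) ω) ∂μ := by
          refine lintegral_mono_ae ?_
          filter_upwards [h.ae_adj hdeg] with ω hω
          exact hΨ (b + k) ω (by omega) hω
      _ = ∫⁻ ω, choiceMean G (Ψ (b + k) ω) ∂μ := h.lintegral_choice hdeg (hdet _)
      _ ≤ ∫⁻ ω, κ * Y (b + k) ω ∂μ := lintegral_mono fun ω => hmean _ ω (by omega)
      _ = κ * ∫⁻ ω, Y (b + k) ω ∂μ := lintegral_const_mul' _ _ hκ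
      _ ≤ κ * (κ ^ k * ∫⁻ ω, Y b ω ∂μ) := mul_le_mul_right ih _
      _ = _ := by ring

/-- Markov's inequality. -/
lemma measure_le_of_lintegral_le (h : IsExecution G s μ ℱ choice conf) {t : ℕ} {Y : Ω → ℝ≥0∞}
    (hY : Determined choice conf t Y) {A : Set Ω} {a b : ℝ≥0∞} (hA : ∀ ω ∈ A, a ≤ Y ω)
    (ha : a ≠ 0) (ha' : a ≠ ⊤) (hb : ∫⁻ ω, Y ω ∂μ ≤ b) : μ A ≤ b / a := by
  have hm : Measurable Y := (h.measurable_of_determined hY).mono (ℱ.le t) le_rfl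
  calc μ A ≤ μ {ω | a ≤ Y ω} := measure_mono hA
    _ ≤ (∫⁻ ω, Y ω ∂μ) / a := meas_ge_le_lintegral_div hm.aemeasurable ha ha'
    _ ≤ b / a := ENNReal.div_le_div_right hb a

end IsExecution

/-! ### Halted processes and the dominating critical queue -/

/-- The process `q`, halted as soon as `halt` holds. -/
noncomputable def frozen (halt : ℕ → Prop) (q : ℕ → ℕ) : ℕ → ℕ
  | 0 => q 0
  | t + 1 => open Classical in if halt t then frozen halt q t else q (t + 1)

lemma frozen_of_not_halt {halt : ℕ → Prop} {q : ℕ → ℕ} {t : ℕ} (h : ∀ τ < t, ¬ halt τ) :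
    frozen halt q t = q t := by
  cases t with
  | zero => rfl
  | succ t => simp [frozen, h t (Nat.lt_succ_self t)]

lemma frozen_of_halt {halt : ℕ → Prop} {q : ℕ → ℕ} {g t : ℕ} (hgt : g ≤ t)
    (h : ∀ τ < g, ¬ halt τ) (h' : ∀ τ, g ≤ τ → halt τ) : frozen halt q t = q g := by
  induction hgt with
  | refl => exact frozen_of_not_halt h
  | step hle ih => rw [frozen, if_pos (h' _ hle), ih]

/-- The number of messages that wait at `v` if all nodes, informed or not, send requests. -/
noncomputable def load [Fintype V] (choice : ℕ → V → V) (v : V) : ℕ → ℕ :=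
  backlog fun t => selections (choice t) v

/-! ### One-step exponential moments -/

section onestep
open Classical
variable [Fintype V] (G : SimpleGraph V) [DecidableRel G.Adj] {Δ : ℕ}

/-- Combine `e ^ y ≤ 1 + y + y ^ 2` for `|y| ≤ 1` with `1 + x ≤ e ^ x`. The linear term has
coefficient exactly one, so that the service can cancel it later. -/
lemma mean_exp_le (hΔ : 0 < Δ) (hreg : G.IsRegularOfDegree Δ) (y : V → ℝ) (hy : ∀ w, |y w| ≤ 1)
    (v : V) :
    (∑ w ∈ G.neighborFinset v, ENNReal.ofReal (Real.exp (y w))) * (G.degree v : ℝ≥0∞)⁻¹ ≤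
      ENNReal.ofReal (Real.exp ((∑ w ∈ G.neighborFinset v, (y w + y w ^ 2)) / Δ)) := by
  have hΔ' : (0 : ℝ) < Δ := by exact_mod_cast hΔ
  rw [← ENNReal.ofReal_sum_of_nonneg fun _ _ => (Real.exp_pos _).le, hreg.degree_eq v,
    ← div_eq_mul_inv, ← ENNReal.ofReal_natCast, ← ENNReal.ofReal_div_of_pos hΔ']
  refine ENNReal.ofReal_le_ofReal ?_
  have h1 : ∑ w ∈ G.neighborFinset v, Real.exp (y w) ≤
      ∑ w ∈ G.neighborFinset v, (1 + (y w + y w ^ 2)) := by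
    refine Finset.sum_le_sum fun w _ => ?_
    have := (abs_le.1 (Real.abs_exp_sub_one_sub_id_le (hy w))).2
    linarith
  rw [Finset.sum_add_distrib, Finset.sum_const, SimpleGraph.card_neighborFinset_eq_degree,
    hreg.degree_eq v, nsmul_one] at h1
  refine le_trans ?_ (Real.add_one_le_exp _)
  rw [div_le_iff₀ hΔ', add_mul, div_mul_cancel₀ _ hΔ'.ne']
  linarith

/-- Double counting. Together with the factor `1 / Δ` of the uniform choice it says that every node
is selected once per step on average. -/
lemma sum_neighbors (hreg : G.IsRegularOfDegree Δ) (f : V → ℝ) :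
    ∑ v, ∑ w ∈ G.neighborFinset v, f w = Δ * ∑ w, f w := by
  have : ∀ v, ∑ w ∈ G.neighborFinset v, f w = ∑ w, if G.Adj w v then f w else 0 := by
    intro v
    rw [← Finset.sum_filter]
    refine Finset.sum_congr ?_ fun _ _ => rfl
    ext w; simp [G.adj_comm]
  simp_rw [this]
  rw [Finset.sum_comm, Finset.mul_sum]
  refine Finset.sum_congr rfl fun w _ => ?_
  rw [← Finset.sum_filter, Finset.sum_const, nsmul_eq_mul]
  have : (Finset.univ.filter fun v => G.Adj w v) = G.neighborFinset w := by ext; simp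
  rw [this, SimpleGraph.card_neighborFinset_eq_degree, hreg.degree_eq]

lemma mean_prod_exp_le (hΔ : 0 < Δ) (hreg : G.IsRegularOfDegree Δ) (y : V → ℝ)
    (hy : ∀ w, |y w| ≤ 1) :
    choiceMean G (fun c => ∏ v, ENNReal.ofReal (Real.exp (y (c v)))) ≤
      ENNReal.ofReal (Real.exp (∑ w, (y w + y w ^ 2))) := by
  have hΔ' : (0 : ℝ) < Δ := by exact_mod_cast hΔ
  rw [choiceMean_prod G fun _ w => ENNReal.ofReal (Real.exp (y w))]
  refine (Finset.prod_le_prod' fun v _ => mean_exp_le G hΔ hreg y hy v).trans (le_of_eq ?_)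
  rw [← ENNReal.ofReal_prod_of_nonneg fun _ _ => (Real.exp_pos _).le, ← Real.exp_sum,
    ← Finset.sum_div, sum_neighbors G hreg, mul_div_cancel_left₀ _ hΔ'.ne']

/-- The numbers of selections of different nodes are dependent, but the choices of different nodes
are not. Expanding the product of `e ^ x + e ^ (-x)` over sign patterns `ε` turns each term into a
product over the choosing nodes. The service `-1` cancels the linear term `θ ∑ ε` for every pattern,
and only the factor `exp (θ ^ 2 |J|)` remains. -/
lemma mean_prod_cosh_le (hΔ : 0 < Δ) (hreg : G.IsRegularOfDegree Δ) {θ : ℝ} (h0 : 0 ≤ θ)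
    (h1 : θ ≤ 1) (J : Finset V) (x : V → ℝ) :
    choiceMean G (fun c => ∏ i ∈ J,
        ENNReal.ofReal (2 * Real.cosh (θ * (x i + selections c i - 1)))) ≤
      ENNReal.ofReal (Real.exp (θ ^ 2 * J.card)) *
        ∏ i ∈ J, ENNReal.ofReal (2 * Real.cosh (θ * x i)) := by
  have hcosh : ∀ a : ℝ, ENNReal.ofReal (2 * Real.cosh a) =
      ENNReal.ofReal (Real.exp a) + ENNReal.ofReal (Real.exp (-a)) := by
    intro a
    rw [← ENNReal.ofReal_add (Real.exp_pos _).le (Real.exp_pos _).le, Real.cosh_eq]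
    congr 1; ring
  simp_rw [hcosh, Finset.prod_add]
  rw [choiceMean_sum, Finset.mul_sum]
  refine Finset.sum_le_sum fun T hT => ?_
  rw [Finset.mem_powerset] at hT
  -- `T` is the set of nodes of `J` that receive the sign `+`.
  set ε : V → ℝ := fun i => if i ∈ T then 1 else if i ∈ J then -1 else 0 with hε
  have hprod : ∀ z : V → ℝ, (∏ i ∈ T, ENNReal.ofReal (Real.exp (θ * z i))) *
      ∏ i ∈ J \ T, ENNReal.ofReal (Real.exp (-(θ * z i))) =
        ENNReal.ofReal (Real.exp (∑ i ∈ J, θ * ε i * z i)) := by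
    intro z
    rw [Real.exp_sum, ENNReal.ofReal_prod_of_nonneg fun _ _ => (Real.exp_pos _).le,
      ← Finset.prod_sdiff hT, mul_comm]
    congr 1
    · refine Finset.prod_congr rfl fun i hi => ?_
      rw [Finset.mem_sdiff] at hi
      simp [hε, hi.1, hi.2]
    · refine Finset.prod_congr rfl fun i hi => ?_
      simp [hε, hi]
  have hε0 : ∀ i, i ∉ J → ε i = 0 := by
    intro i hi
    simp [hε, hi, show i ∉ T from fun h => hi (hT h)]
  have hε2 : ∀ i ∈ J, ε i ^ 2 = 1 := by
    intro i hi
    simp only [hε, hi, if_true]; split_ifs <;> norm_num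
  have hεabs : ∀ i, |ε i| ≤ 1 := by
    intro i
    simp only [hε]; split_ifs <;> norm_num
  have hsel : ∀ c : V → V, ∑ i ∈ J, θ * ε i * (x i + selections c i - 1) =
      ∑ i ∈ J, θ * ε i * (x i - 1) + ∑ v, θ * ε (c v) := by
    intro c
    have h3 : ∑ v, θ * ε (c v) = ∑ i ∈ J, θ * ε i * selections c i := by
      have h4 : ∀ v, θ * ε (c v) = ∑ i ∈ J, if c v = i then θ * ε i else 0 := by
        intro v
        rw [Finset.sum_ite_eq]
        split_ifs with hv
        · rfl
        · rw [hε0 _ hv, mul_zero]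
      simp_rw [h4]
      rw [Finset.sum_comm]
      refine Finset.sum_congr rfl fun i _ => ?_
      rw [← Finset.sum_filter, Finset.sum_const, nsmul_eq_mul, mul_comm]
      rfl
    rw [h3, ← Finset.sum_add_distrib]
    exact Finset.sum_congr rfl fun i _ => by ring
  have hfac : ∀ c : V → V, (∏ i ∈ T, ENNReal.ofReal (Real.exp (θ * (x i + selections c i - 1)))) *
      ∏ i ∈ J \ T, ENNReal.ofReal (Real.exp (-(θ * (x i + selections c i - 1)))) =
        ENNReal.ofReal (Real.exp (∑ i ∈ J, θ * ε i * (x i - 1))) *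
          ∏ v, ENNReal.ofReal (Real.exp (θ * ε (c v))) := by
    intro c
    rw [hprod fun i => x i + selections c i - 1, hsel, Real.exp_add,
      ENNReal.ofReal_mul (Real.exp_pos _).le, Real.exp_sum Finset.univ,
      ENNReal.ofReal_prod_of_nonneg fun _ _ => (Real.exp_pos _).le]
  rw [funext hfac, choiceMean_const_mul, hprod]
  refine (mul_le_mul_right (mean_prod_exp_le G hΔ hreg (fun w => θ * ε w) fun w => ?_) _).trans
    (le_of_eq ?_)
  · rw [abs_mul, abs_of_nonneg h0]
    exact mul_le_one₀ h1 (abs_nonneg _) (hεabs w)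
  · rw [← ENNReal.ofReal_mul (Real.exp_pos _).le, ← ENNReal.ofReal_mul (Real.exp_pos _).le,
      ← Real.exp_add, ← Real.exp_add]
    congr 2
    have h5 : ∑ w, (θ * ε w + (θ * ε w) ^ 2) = ∑ w ∈ J, (θ * ε w + θ ^ 2) := by
      rw [← Finset.sum_subset (Finset.subset_univ J)]
      · exact Finset.sum_congr rfl fun w hw => by rw [mul_pow, hε2 w hw, mul_one]
      · intro w _ hw
        rw [hε0 w hw]; simp
    rw [h5, ← Finset.sum_add_distrib]
    have h6 : θ ^ 2 * J.card = ∑ _w ∈ J, θ ^ 2 := by simp [mul_comm]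
    rw [h6, ← Finset.sum_add_distrib]
    exact Finset.sum_congr rfl fun w _ => by ring

/-- The mean of a product of functions of the choices of the members of `I`. -/
lemma choiceMean_prod_finset (hdeg : ∀ v, 0 < G.degree v) (I : Finset V) (f : V → V → ℝ≥0∞) :
    choiceMean G (fun c => ∏ v ∈ I, f v (c v)) =
      ∏ v ∈ I, ((∑ w ∈ G.neighborFinset v, f v w) * (G.degree v : ℝ≥0∞)⁻¹) := by
  have h1 : ∀ c : V → V, ∏ v ∈ I, f v (c v) = ∏ v, (if v ∈ I then f v (c v) else 1) := by
    intro c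
    rw [Finset.prod_ite_mem, Finset.univ_inter]
  rw [funext h1, choiceMean_prod G fun v w => if v ∈ I then f v w else 1]
  rw [← Finset.prod_subset (Finset.subset_univ I)]
  · exact Finset.prod_congr rfl fun v hv => by simp [hv]
  · intro v _ hv
    simp only [hv, if_false, Finset.sum_const, nsmul_one,
      SimpleGraph.card_neighborFinset_eq_degree]
    exact ENNReal.mul_inv_cancel (by exact_mod_cast (hdeg v).ne') (ENNReal.natCast_ne_top _)

lemma exp_half_le : Real.exp (1 / 2) ≤ 5 / 3 := by
  have h1 : Real.exp (1 / 2) ^ 2 = Real.exp 1 := by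
    rw [← Real.exp_nat_mul]; norm_num
  have h2 := Real.exp_one_lt_d9
  nlinarith [Real.exp_pos (1 / 2)]

/-- If at least half of the neighbors of `u` are informed, then few requests arrive at `u`. -/
lemma mean_requests_le (hΔ : 0 < Δ) (hreg : G.IsRegularOfDegree Δ) (σ : Config V) (u : V)
    (hσ : Δ ≤ 2 * ((G.neighborFinset u).filter fun w => w ∈ σ.informed).card) :
    choiceMean G (fun c => 2 ^ σ.requests c u) ≤ ENNReal.ofReal (5 / 3) := by
  have hΔ' : (0 : ℝ) < Δ := by exact_mod_cast hΔ
  have h1 : ∀ c : V → V, (2 : ℝ≥0∞) ^ σ.requests c u =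
      ∏ v, if v ∉ σ.informed ∧ c v = u then 2 else 1 := by
    intro c
    rw [Finset.prod_ite, Finset.prod_const_one, mul_one, Finset.prod_const]
    rfl
  rw [funext h1, choiceMean_prod G fun v w => if v ∉ σ.informed ∧ w = u then 2 else 1]
  set B := (G.neighborFinset u).filter fun w => w ∉ σ.informed with hB
  have hcard : 2 * B.card ≤ Δ := by
    have : ((G.neighborFinset u).filter fun w => w ∈ σ.informed).card + B.card = Δ := by
      rw [← hreg.degree_eq u, ← SimpleGraph.card_neighborFinset_eq_degree, hB]
      convert Finset.card_filter_add_card_filter_not (s := G.neighborFinset u)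
        (fun w => w ∈ σ.informed)
    omega
  have h2 : ∀ v, (∑ w ∈ G.neighborFinset v, if v ∉ σ.informed ∧ w = u then (2 : ℝ≥0∞) else 1) *
      (G.degree v : ℝ≥0∞)⁻¹ ≤ ENNReal.ofReal (Real.exp (if v ∈ B then 1 / Δ else 0)) := by
    intro v
    have h3 : (∑ w ∈ G.neighborFinset v, if v ∉ σ.informed ∧ w = u then (2 : ℝ≥0∞) else 1) =
        ENNReal.ofReal (Δ + if v ∈ B then 1 else 0) := by
      have h4 : ∀ w, (if v ∉ σ.informed ∧ w = u then (2 : ℝ≥0∞) else 1) =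
          ENNReal.ofReal (1 + if w = u then (if v ∉ σ.informed then 1 else 0) else 0) := by
        intro w
        by_cases h5 : w = u <;> by_cases h6 : v ∈ σ.informed <;> simp [h5, h6]
        norm_num
      simp_rw [h4]
      rw [← ENNReal.ofReal_sum_of_nonneg (fun w _ => by positivity)]
      rw [Finset.sum_add_distrib, Finset.sum_ite_eq', Finset.sum_const,
        SimpleGraph.card_neighborFinset_eq_degree, hreg.degree_eq, nsmul_one]
      congr 2
      simp only [hB, Finset.mem_filter, SimpleGraph.mem_neighborFinset, G.adj_comm v u]
      by_cases h5 : G.Adj u v <;> simp [h5]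
    rw [h3, hreg.degree_eq v, ← div_eq_mul_inv, ← ENNReal.ofReal_natCast,
      ← ENNReal.ofReal_div_of_pos hΔ']
    refine ENNReal.ofReal_le_ofReal (le_trans (le_of_eq ?_) (Real.add_one_le_exp _))
    rw [add_div, div_self hΔ'.ne']
    split_ifs <;> simp [add_comm]
  refine (Finset.prod_le_prod' fun v _ => h2 v).trans ?_
  rw [← ENNReal.ofReal_prod_of_nonneg fun _ _ => (Real.exp_pos _).le, ← Real.exp_sum,
    Finset.sum_ite_mem, Finset.univ_inter, Finset.sum_const, nsmul_eq_mul]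
  refine ENNReal.ofReal_le_ofReal (le_trans (Real.exp_le_exp.2 ?_) exp_half_le)
  rw [mul_one_div, div_le_div_iff₀ hΔ' two_pos]
  have : (2 * B.card : ℝ) ≤ Δ := by exact_mod_cast hcard
  linarith

/-- If at most half of the neighbors of `u` are reached, then `u` seldom selects one of them. -/
lemma mean_useful_le (hΔ : 0 < Δ) (hreg : G.IsRegularOfDegree Δ) (σ : Config V) (u : V)
    (hσ : 2 * ((G.neighborFinset u).filter fun w => σ.Reached w).card ≤ Δ) :
    choiceMean G (fun c => 2 ^ σ.useful c u) ≤ ENNReal.ofReal (5 / 3) := by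
  have hΔ' : (0 : ℝ) < Δ := by exact_mod_cast hΔ
  have hdeg : ∀ v, 0 < G.degree v := fun v => by rw [hreg.degree_eq]; exact hΔ
  refine (choiceMean_mono G (g := fun c => ∏ v ∈ {u}, if σ.Reached (c v) then 2 else 1)
    fun c _ => ?_).trans ?_
  · rw [Finset.prod_singleton, Config.useful]
    split_ifs with h1 h2 h2
    · simp
    · exact absurd h1.2 h2
    · simp
    · simp
  rw [choiceMean_prod_finset G hdeg _ fun _ w => if σ.Reached w then 2 else 1,
    Finset.prod_singleton, hreg.degree_eq]
  have h4 : ∀ w, (if σ.Reached w then (2 : ℝ≥0∞) else 1) =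
      ENNReal.ofReal (1 + if σ.Reached w then 1 else 0) := by
    intro w
    by_cases h5 : σ.Reached w <;> simp [h5]
    norm_num
  simp_rw [h4]
  rw [← ENNReal.ofReal_sum_of_nonneg (fun w _ => by positivity), Finset.sum_add_distrib,
    Finset.sum_const, SimpleGraph.card_neighborFinset_eq_degree, hreg.degree_eq, nsmul_one,
    ← Finset.sum_filter, Finset.sum_const, nsmul_one, ← div_eq_mul_inv,
    ← ENNReal.ofReal_natCast, ← ENNReal.ofReal_div_of_pos hΔ']
  refine ENNReal.ofReal_le_ofReal ?_
  rw [div_le_iff₀ hΔ']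
  have : (2 * ((G.neighborFinset u).filter fun w => σ.Reached w).card : ℝ) ≤ Δ := by
    exact_mod_cast hσ
  linarith

end onestep

/-! ### Dependence on the history, and recursions for hits and gaps -/

lemma backlog_congr {a b : ℕ → ℕ} {t : ℕ} (h : ∀ τ < t, a τ = b τ) : backlog a t = backlog b t := by
  induction t with
  | zero => rfl
  | succ t ih =>
    rw [backlog, backlog, ih fun τ hτ => h τ (by omega), h t (by omega)]

lemma frozen_congr {p p' : ℕ → Prop} {q q' : ℕ → ℕ} {t : ℕ} (hp : ∀ τ < t, p τ ↔ p' τ)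
    (hq : ∀ τ ≤ t, q τ = q' τ) : frozen p q t = frozen p' q' t := by
  induction t with
  | zero => exact hq 0 le_rfl
  | succ t ih =>
    have h1 : p t ↔ p' t := hp t (Nat.lt_succ_self t)
    by_cases h2 : p t
    · rw [frozen, frozen, if_pos h2, if_pos (h1.1 h2),
        ih (fun τ hτ => hp τ (by omega)) fun τ hτ => hq τ (by omega)]
    · rw [frozen, frozen, if_neg h2, if_neg (mt h1.2 h2), hq (t + 1) le_rfl]

lemma armed_congr {conf conf' : ℕ → Config V} {t : ℕ} (h : ∀ τ < t, conf τ = conf' τ) (w : V) :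
    Armed conf w t ↔ Armed conf' w t := by
  constructor
  · rintro ⟨τ, h1, h2⟩; exact ⟨τ, h1, h τ h1 ▸ h2⟩
  · rintro ⟨τ, h1, h2⟩; exact ⟨τ, h1, (h τ h1).symm ▸ h2⟩

lemma hit_congr {conf conf' : ℕ → Config V} {choice choice' : ℕ → V → V} {t : ℕ}
    (h : ∀ τ < t, conf τ = conf' τ) (h' : ∀ τ < t, choice τ = choice' τ) (u w : V) :
    Hit conf choice u w t ↔ Hit conf' choice' u w t := by
  constructor
  · rintro ⟨τ, h1, h2, h3⟩
    exact ⟨τ, h1, (armed_congr (fun i hi => h i (by omega)) w).1 h2, h' τ h1 ▸ h3⟩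
  · rintro ⟨τ, h1, h2, h3⟩
    exact ⟨τ, h1, (armed_congr (fun i hi => h i (by omega)) w).2 h2, (h' τ h1).symm ▸ h3⟩

lemma gap_congr {conf conf' : ℕ → Config V} {choice choice' : ℕ → V → V} {t : ℕ}
    (h : ∀ τ < t, conf τ = conf' τ) (h' : ∀ τ < t, choice τ = choice' τ) (u w : V) :
    gap conf choice u w t = gap conf' choice' u w t := by
  classical
  unfold gap
  congr 1
  refine Finset.filter_congr fun τ hτ => ?_
  rw [Finset.mem_range] at hτ
  rw [armed_congr (fun i hi => h i (by omega)), hit_congr (fun i hi => h i (by omega))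
    (fun i hi => h' i (by omega))]

lemma gap_succ (conf : ℕ → Config V) (choice : ℕ → V → V) (u w : V) (t : ℕ) :
    gap conf choice u w (t + 1) = gap conf choice u w t +
      open Classical in if Armed conf w t ∧ ¬ Hit conf choice u w t then 1 else 0 := by
  classical
  unfold gap
  rw [Finset.range_add_one, Finset.filter_insert]
  split_ifs with h
  · rw [Finset.card_insert_of_notMem (by simp)]
  · simp

lemma hit_succ (conf : ℕ → Config V) (choice : ℕ → V → V) (u w : V) (t : ℕ) :
    Hit conf choice u w (t + 1) ↔
      Hit conf choice u w t ∨ (Armed conf w t ∧ choice t u = w) := by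
  constructor
  · rintro ⟨τ, h1, h2⟩
    rcases Nat.lt_succ_iff_lt_or_eq.1 h1 with h3 | rfl
    · exact Or.inl ⟨τ, h3, h2⟩
    · exact Or.inr h2
  · rintro (⟨τ, h1, h2⟩ | h)
    · exact ⟨τ, by omega, h2⟩
    · exact ⟨t, by omega, h⟩

/-- Bernoulli's inequality: a gap of `2 Δ` steps is worth a factor of two. -/
lemma two_pow_le_growth {Δ : ℕ} (hΔ : 0 < Δ) (k : ℕ) :
    (2 : ℝ≥0∞) ^ k ≤ ENNReal.ofReal (1 + 1 / (2 * Δ)) ^ (2 * Δ * k) := by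
  have hΔ' : (0 : ℝ) < Δ := by exact_mod_cast hΔ
  rw [pow_mul]
  refine pow_le_pow_left₀ zero_le ?_ k
  rw [← ENNReal.ofReal_pow (by positivity)]
  rw [show (2 : ℝ≥0∞) = ENNReal.ofReal 2 by norm_num]
  refine ENNReal.ofReal_le_ofReal ?_
  have := one_add_mul_le_pow (a := (1 / (2 * Δ : ℝ))) (by
    have : (0:ℝ) ≤ 1 / (2 * Δ) := by positivity
    linarith) (2 * Δ)
  refine le_trans (le_of_eq ?_) this
  push_cast
  field_simp
  norm_num

/-! ### Exponential moments and tail bounds for executions -/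

namespace IsExecution
variable [Fintype V] {G : SimpleGraph V} [DecidableRel G.Adj] {s : V} {Δ : ℕ}
    {Ω : Type*} [mΩ : MeasurableSpace Ω] {μ : Measure Ω} [IsProbabilityMeasure μ]
    {ℱ : Filtration ℕ mΩ} {choice : ℕ → Ω → V → V} {conf : ℕ → Ω → Config V}

/-- The exponential moments of the loads of a set of nodes at haltping times. -/
lemma lintegral_prod_cosh_le (h : IsExecution G s μ ℱ choice conf) (hΔ : 0 < Δ)
    (hreg : G.IsRegularOfDegree Δ) {θ : ℝ} (h0 : 0 ≤ θ) (h1 : θ ≤ 1) (I : Finset V)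
    (halt : V → ℕ → Ω → Prop) (hdet : ∀ i t, Determined choice conf t (halt i t))
    (hmono : ∀ i ω t, halt i t ω → halt i (t + 1) ω) (t : ℕ) :
    ∫⁻ ω, ∏ i ∈ I, ENNReal.ofReal (2 * Real.cosh (θ *
        frozen (fun τ => halt i τ ω) (load (fun τ => choice τ ω) i) t)) ∂μ ≤
      ENNReal.ofReal (Real.exp (θ ^ 2 * I.card)) ^ t * 2 ^ I.card := by
  classical
  have hdeg : ∀ v, 0 < G.degree v := fun v => by rw [hreg.degree_eq]; exact hΔ
  have hload : ∀ i t, Determined choice conf t fun ω => load (fun τ => choice τ ω) i t := by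
    intro i t ω ω' _ hc
    exact backlog_congr fun τ hτ => by simp only [hc τ hτ]
  have hfrozen : ∀ i t, Determined choice conf t
      fun ω => frozen (fun τ => halt i τ ω) (load (fun τ => choice τ ω) i) t := by
    intro i t ω ω' hf hc
    refine frozen_congr (fun τ hτ => ?_) fun τ hτ => ?_
    · exact iff_of_eq (hdet i τ ω ω' (fun j hj => hf j (by omega)) fun j hj => hc j (by omega))
    · exact hload i τ ω ω' (fun j hj => hf j (by omega)) fun j hj => hc j (by omega)
  have hns : ∀ i t ω, ¬ halt i t ω → frozen (fun τ => halt i τ ω)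
      (load (fun τ => choice τ ω) i) t = load (fun τ => choice τ ω) i t := by
    intro i t ω hn
    refine frozen_of_not_halt fun τ hτ hs => hn ?_
    have : ∀ k, halt i (τ + k) ω := by
      intro k
      induction k with
      | zero => exact hs
      | succ k ih => exact hmono i ω _ ih
    rw [← Nat.add_sub_cancel' hτ.le]
    exact this _
  have key := h.lintegral_le_pow hdeg (κ := ENNReal.ofReal (Real.exp (θ ^ 2 * I.card)))
    ENNReal.ofReal_ne_top 0
    (fun t ω => ∏ i ∈ I, ENNReal.ofReal (2 * Real.cosh (θ *
        frozen (fun τ => halt i τ ω) (load (fun τ => choice τ ω) i) t)))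
    (fun t ω c => (∏ i ∈ I.filter fun i => halt i t ω, ENNReal.ofReal (2 * Real.cosh (θ *
        frozen (fun τ => halt i τ ω) (load (fun τ => choice τ ω) i) t))) *
      ∏ i ∈ I.filter fun i => ¬ halt i t ω, ENNReal.ofReal (2 * Real.cosh (θ *
        ((load (fun τ => choice τ ω) i t : ℝ) + selections c i - 1)))) ?_ ?_ ?_ t
  · simp only [zero_add] at key
    refine key.trans (le_of_eq ?_)
    simp [frozen, load, backlog]
  · intro t c ω ω' hf hc
    have e1 : ∀ i, halt i t ω = halt i t ω' := fun i => hdet i t ω ω' hf hc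
    have e2 : ∀ i, load (fun τ => choice τ ω) i t = load (fun τ => choice τ ω') i t :=
      fun i => hload i t ω ω' hf hc
    have e3 : ∀ i, frozen (fun τ => halt i τ ω) (load (fun τ => choice τ ω) i) t =
        frozen (fun τ => halt i τ ω') (load (fun τ => choice τ ω') i) t :=
      fun i => hfrozen i t ω ω' hf hc
    simp only [e1, e2, e3]
  · intro t ω _ _
    refine le_of_eq_of_le (Finset.prod_filter_mul_prod_filter_not I (fun i => halt i t ω) _).symm ?_
    refine mul_le_mul' (Finset.prod_le_prod' fun i hi => ?_) (Finset.prod_le_prod' fun i hi => ?_)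
    · rw [Finset.mem_filter] at hi
      rw [frozen, if_pos hi.2]
    · rw [Finset.mem_filter] at hi
      rw [frozen, if_neg hi.2]
      refine ENNReal.ofReal_le_ofReal (mul_le_mul_of_nonneg_left ?_ zero_le_two)
      -- The queue is reflected at zero: when it is empty and nobody selects `i`, it stays at `0`
      -- instead of moving to `-1`. This does not increase the absolute value, which is why an even
      -- function such as `cosh` is used instead of `exp`.
      rw [Real.cosh_le_cosh, abs_mul, abs_mul]
      refine mul_le_mul_of_nonneg_left ?_ (abs_nonneg _)
      have e : load (fun τ => choice τ ω) i (t + 1) =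
        load (fun τ => choice τ ω) i t + selections (choice t ω) i - 1 := rfl
      rw [e]
      rcases Nat.eq_zero_or_pos (load (fun τ => choice τ ω) i t + selections (choice t ω) i)
        with h2 | h2
      · rw [h2]; simp
      · rw [Nat.cast_sub h2]; push_cast; exact le_rfl
  · intro t ω _
    rw [choiceMean_const_mul]
    refine (mul_le_mul_right (mean_prod_cosh_le G hΔ hreg h0 h1 _
      fun i => (load (fun τ => choice τ ω) i t : ℝ)) _).trans ?_
    rw [mul_left_comm]
    refine mul_le_mul' (ENNReal.ofReal_le_ofReal (Real.exp_le_exp.2 ?_)) (le_of_eq ?_)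
    · exact mul_le_mul_of_nonneg_left (by exact_mod_cast Finset.card_filter_le _ _) (sq_nonneg _)
    · rw [← Finset.prod_filter_mul_prod_filter_not I (fun i => halt i t ω)]
      congr 1
      refine Finset.prod_congr rfl fun i hi => ?_
      rw [hns i t ω (Finset.mem_filter.1 hi).2]

lemma measure_sum_frozen_le (h : IsExecution G s μ ℱ choice conf) (hΔ : 0 < Δ)
    (hreg : G.IsRegularOfDegree Δ) {θ : ℝ} (h0 : 0 ≤ θ) (h1 : θ ≤ 1) (I : Finset V)
    (halt : V → ℕ → Ω → Prop) (hdet : ∀ i t, Determined choice conf t (halt i t))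
    (hmono : ∀ i ω t, halt i t ω → halt i (t + 1) ω) (t z : ℕ) :
    μ {ω | z ≤ ∑ i ∈ I, frozen (fun τ => halt i τ ω) (load (fun τ => choice τ ω) i) t} ≤
      2 ^ I.card * ENNReal.ofReal (Real.exp (θ ^ 2 * I.card * t - θ * z)) := by
  have hfrozen : ∀ i t, Determined choice conf t
      fun ω => frozen (fun τ => halt i τ ω) (load (fun τ => choice τ ω) i) t := by
    intro i t ω ω' hf hc
    refine frozen_congr (fun τ hτ => ?_) fun τ hτ => ?_
    · exact iff_of_eq (hdet i τ ω ω' (fun j hj => hf j (by omega)) fun j hj => hc j (by omega))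
    · exact backlog_congr fun j hj => by simp only [hc j (by omega)]
  refine (h.measure_le_of_lintegral_le (t := t) (a := ENNReal.ofReal (Real.exp (θ * z))) ?_ ?_ ?_
    ENNReal.ofReal_ne_top
    (h.lintegral_prod_cosh_le hΔ hreg h0 h1 I halt hdet hmono t)).trans (le_of_eq ?_)
  · intro ω ω' hf hc
    refine Finset.prod_congr rfl fun i _ => ?_
    have e : frozen (fun τ => halt i τ ω) (load (fun τ => choice τ ω) i) t =
        frozen (fun τ => halt i τ ω') (load (fun τ => choice τ ω') i) t := hfrozen i t ω ω' hf hc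
    rw [e]
  · intro ω hω
    rw [← ENNReal.ofReal_prod_of_nonneg fun _ _ => by positivity]
    refine ENNReal.ofReal_le_ofReal ?_
    have h3 : θ * z ≤ ∑ i ∈ I, θ *
        (frozen (fun τ => halt i τ ω) (load (fun τ => choice τ ω) i) t : ℝ) := by
      rw [← Finset.mul_sum]
      exact mul_le_mul_of_nonneg_left (by exact_mod_cast hω) h0
    refine (Real.exp_le_exp.2 h3).trans ?_
    rw [Real.exp_sum]
    refine Finset.prod_le_prod (fun _ _ => (Real.exp_pos _).le) fun i _ => ?_
    rw [Real.cosh_eq]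
    linarith [Real.exp_pos (-(θ *
      (frozen (fun τ => halt i τ ω) (load (fun τ => choice τ ω) i) t : ℝ)))]
  · exact (ENNReal.ofReal_pos.2 (Real.exp_pos _)).ne'
  · rw [← ENNReal.ofReal_pow (Real.exp_pos _).le, ← Real.exp_nat_mul, mul_comm, mul_div_assoc,
      ← ENNReal.ofReal_div_of_pos (Real.exp_pos _), ← Real.exp_sub]
    congr 4
    ring

/-- The exponential moments of the gaps of nodes that wait for different neighbors. -/
lemma lintegral_prod_gap_le (h : IsExecution G s μ ℱ choice conf) (hΔ : 0 < Δ)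
    (hreg : G.IsRegularOfDegree Δ) (I : Finset V) (nxt : V → V) (hnxt : ∀ u ∈ I, G.Adj u (nxt u))
    (t : ℕ) :
    ∫⁻ ω, ∏ u ∈ I, (open Classical in
      (if Hit (fun τ => conf τ ω) (fun τ => choice τ ω) u (nxt u) t then 1 else 2) *
      ENNReal.ofReal (1 + 1 / (2 * Δ)) ^
        gap (fun τ => conf τ ω) (fun τ => choice τ ω) u (nxt u) t) ∂μ ≤ 2 ^ I.card := by
  classical
  have hΔ' : (0 : ℝ) < Δ := by exact_mod_cast hΔ
  have hdeg : ∀ v, 0 < G.degree v := fun v => by rw [hreg.degree_eq]; exact hΔ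
  set β := ENNReal.ofReal (1 + 1 / (2 * Δ)) with hβ
  -- The factor `2` before the hit pays for the future gap and makes the product a supermartingale.
  -- While `u` waits, the one-step mean is `(2 Δ - 1) / Δ * (1 + 1 / (2 Δ))`, which is at most `2`.
  have key := h.lintegral_le_pow hdeg (κ := 1) ENNReal.one_ne_top 0
    (fun t ω => ∏ u ∈ I,
      ((if Hit (fun τ => conf τ ω) (fun τ => choice τ ω) u (nxt u) t then (1 : ℝ≥0∞) else 2) *
      β ^ gap (fun τ => conf τ ω) (fun τ => choice τ ω) u (nxt u) t))
    (fun t ω c => ∏ u ∈ I,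
      if Hit (fun τ => conf τ ω) (fun τ => choice τ ω) u (nxt u) t then
        β ^ gap (fun τ => conf τ ω) (fun τ => choice τ ω) u (nxt u) t
      else if Armed (fun τ => conf τ ω) (nxt u) t then
        (if c u = nxt u then 1 else 2) *
          β ^ (gap (fun τ => conf τ ω) (fun τ => choice τ ω) u (nxt u) t + 1)
      else 2 * β ^ gap (fun τ => conf τ ω) (fun τ => choice τ ω) u (nxt u) t) ?_ ?_ ?_ t
  · simp only [zero_add, one_pow, one_mul] at key
    refine key.trans (le_of_eq ?_)
    simp [Hit, gap]
  · intro t c ω ω' hf hc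
    refine Finset.prod_congr rfl fun u _ => ?_
    have e1 := hit_congr (conf := fun τ => conf τ ω) (conf' := fun τ => conf τ ω')
      (choice := fun τ => choice τ ω) (choice' := fun τ => choice τ ω')
      (fun i hi => hf i hi.le) hc u (nxt u)
    have e2 := gap_congr (conf := fun τ => conf τ ω) (conf' := fun τ => conf τ ω')
      (choice := fun τ => choice τ ω) (choice' := fun τ => choice τ ω')
      (fun i hi => hf i hi.le) hc u (nxt u)
    have e3 := armed_congr (conf := fun τ => conf τ ω) (conf' := fun τ => conf τ ω')
      (fun i hi => hf i (le_of_lt hi)) (nxt u)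
    simp only [e1, e2, e3]
  · intro t ω _ _
    refine Finset.prod_le_prod' fun u _ => le_of_eq ?_
    rw [gap_succ]
    simp only [hit_succ]
    by_cases h1 : Hit (fun τ => conf τ ω) (fun τ => choice τ ω) u (nxt u) t
    · simp [h1]
    · by_cases h2 : Armed (fun τ => conf τ ω) (nxt u) t
      · simp [h1, h2]
      · simp [h1, h2]
  · intro t ω _
    rw [one_mul]
    rw [choiceMean_prod_finset G hdeg I fun u w =>
      if Hit (fun τ => conf τ ω) (fun τ => choice τ ω) u (nxt u) t then
        β ^ gap (fun τ => conf τ ω) (fun τ => choice τ ω) u (nxt u) t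
      else if Armed (fun τ => conf τ ω) (nxt u) t then
        (if w = nxt u then 1 else 2) *
          β ^ (gap (fun τ => conf τ ω) (fun τ => choice τ ω) u (nxt u) t + 1)
      else 2 * β ^ gap (fun τ => conf τ ω) (fun τ => choice τ ω) u (nxt u) t]
    refine Finset.prod_le_prod' fun u hu => ?_
    have hcancel : ∀ a : ℝ≥0∞, (Δ : ℝ≥0∞) * a * (Δ : ℝ≥0∞)⁻¹ = a := by
      intro a
      rw [mul_comm, ← mul_assoc, ENNReal.inv_mul_cancel (by exact_mod_cast hΔ.ne')
        (ENNReal.natCast_ne_top _), one_mul]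
    by_cases h1 : Hit (fun τ => conf τ ω) (fun τ => choice τ ω) u (nxt u) t
    · simp only [h1, if_true, Finset.sum_const, SimpleGraph.card_neighborFinset_eq_degree,
        hreg.degree_eq, nsmul_eq_mul, hcancel, one_mul, le_refl]
    by_cases h2 : Armed (fun τ => conf τ ω) (nxt u) t
    · simp only [h1, h2, if_true, if_false]
      rw [← Finset.sum_mul, pow_succ', hreg.degree_eq]
      have hsum : (∑ w ∈ G.neighborFinset u, if w = nxt u then (1 : ℝ≥0∞) else 2) =
          ENNReal.ofReal (2 * Δ - 1) := by
        have h4 : ∀ w, (if w = nxt u then (1 : ℝ≥0∞) else 2) =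
            ENNReal.ofReal (2 - if w = nxt u then 1 else 0) := by
          intro w
          split_ifs <;> norm_num
        simp_rw [h4]
        rw [← ENNReal.ofReal_sum_of_nonneg (fun w _ => by split_ifs <;> norm_num),
          Finset.sum_sub_distrib, Finset.sum_ite_eq', if_pos (by simpa using hnxt u hu),
          Finset.sum_const, SimpleGraph.card_neighborFinset_eq_degree, hreg.degree_eq,
          nsmul_eq_mul, mul_comm]
      rw [hsum]
      have hle : ENNReal.ofReal (2 * Δ - 1) * β * (Δ : ℝ≥0∞)⁻¹ ≤ 2 := by
        have h5 : (1 : ℝ) ≤ Δ := by exact_mod_cast hΔ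
        rw [hβ, ← ENNReal.ofReal_mul (by linarith), ← div_eq_mul_inv, ← ENNReal.ofReal_natCast,
          ← ENNReal.ofReal_div_of_pos hΔ', show (2 : ℝ≥0∞) = ENNReal.ofReal 2 by norm_num]
        refine ENNReal.ofReal_le_ofReal ?_
        rw [div_le_iff₀ hΔ']
        have : (2 * (Δ : ℝ) - 1) * (1 + 1 / (2 * Δ)) = 2 * Δ - 1 / (2 * Δ) := by
          field_simp; ring
        rw [this]
        have : (0 : ℝ) ≤ 1 / (2 * Δ) := by positivity
        linarith
      calc _ = (ENNReal.ofReal (2 * Δ - 1) * β * (Δ : ℝ≥0∞)⁻¹) * _ := by ring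
        _ ≤ 2 * _ := mul_le_mul_left hle _
    · simp only [h1, h2, if_false, Finset.sum_const, SimpleGraph.card_neighborFinset_eq_degree,
        hreg.degree_eq, nsmul_eq_mul, hcancel, le_refl]

lemma measure_sum_gap_le (h : IsExecution G s μ ℱ choice conf) (hΔ : 0 < Δ)
    (hreg : G.IsRegularOfDegree Δ) (I : Finset V) (nxt : V → V) (hnxt : ∀ u ∈ I, G.Adj u (nxt u))
    (t k : ℕ) :
    μ {ω | 2 * Δ * k ≤ ∑ u ∈ I, gap (fun τ => conf τ ω) (fun τ => choice τ ω) u (nxt u) t} ≤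
      2 ^ I.card / 2 ^ k := by
  classical
  refine h.measure_le_of_lintegral_le (t := t) ?_ ?_ (by positivity) (by simp)
    (h.lintegral_prod_gap_le hΔ hreg I nxt hnxt t)
  · intro ω ω' hf hc
    refine Finset.prod_congr rfl fun u _ => ?_
    have e1 := hit_congr (conf := fun τ => conf τ ω) (conf' := fun τ => conf τ ω')
      (choice := fun τ => choice τ ω) (choice' := fun τ => choice τ ω')
      (fun i hi => hf i hi.le) hc u (nxt u)
    have e2 := gap_congr (conf := fun τ => conf τ ω) (conf' := fun τ => conf τ ω')
      (choice := fun τ => choice τ ω) (choice' := fun τ => choice τ ω')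
      (fun i hi => hf i hi.le) hc u (nxt u)
    simp only [e1, e2]
  · intro ω hω
    have h1 : (1 : ℝ≥0∞) ≤ ENNReal.ofReal (1 + 1 / (2 * Δ)) := by
      rw [← ENNReal.ofReal_one]
      refine ENNReal.ofReal_le_ofReal ?_
      have : (0 : ℝ) ≤ 1 / (2 * Δ) := by positivity
      linarith
    refine (two_pow_le_growth hΔ k).trans ((pow_le_pow_right₀ h1 hω).trans ?_)
    rw [← Finset.prod_pow_eq_pow_sum]
    refine Finset.prod_le_prod' fun u _ => ?_
    refine le_mul_of_one_le_left zero_le ?_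
    split_ifs <;> norm_num

/-- A Chernoff bound for increments with small conditional exponential moments, as long as the
condition `ok` holds. -/
lemma measure_sum_increments_le (h : IsExecution G s μ ℱ choice conf) (hdeg : ∀ v, 0 < G.degree v)
    (ok : Config V → Prop) (a : Config V → (V → V) → ℕ)
    (ha : ∀ σ, ok σ → choiceMean G (fun c => 2 ^ a σ c) ≤ ENNReal.ofReal (5 / 3)) (b k y : ℕ) :
    μ {ω | (∀ τ ∈ Finset.Ico b (b + k), ok (conf τ ω)) ∧
        3 * k + 4 * y < 4 * ∑ τ ∈ Finset.Ico b (b + k), a (conf τ ω) (choice τ ω)} ≤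
      (2 ^ y)⁻¹ := by
  classical
  -- Killing the process at the first failure of `ok` lets its mean grow by at most `5 / 3` per step
  -- without conditions.
  set Y : ℕ → Ω → ℝ≥0∞ := fun t ω => if ∀ τ ∈ Finset.Ico b t, ok (conf τ ω) then
    2 ^ ∑ τ ∈ Finset.Ico b t, a (conf τ ω) (choice τ ω) else 0 with hY
  have hdetY : ∀ t, Determined choice conf t (Y t) := by
    intro t ω ω' hf hc
    simp only [hY]
    have e1 : (∀ τ ∈ Finset.Ico b t, ok (conf τ ω)) ↔ ∀ τ ∈ Finset.Ico b t, ok (conf τ ω') := by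
      refine forall₂_congr fun τ hτ => ?_
      rw [hf τ (Finset.mem_Ico.1 hτ).2.le]
    have e2 : ∑ τ ∈ Finset.Ico b t, a (conf τ ω) (choice τ ω) =
        ∑ τ ∈ Finset.Ico b t, a (conf τ ω') (choice τ ω') := by
      refine Finset.sum_congr rfl fun τ hτ => ?_
      rw [hf τ (Finset.mem_Ico.1 hτ).2.le, hc τ (Finset.mem_Ico.1 hτ).2]
    simp only [e1, e2]
  have key := h.lintegral_le_pow hdeg (κ := ENNReal.ofReal (5 / 3)) ENNReal.ofReal_ne_top b Y
    (fun t ω c => if ok (conf t ω) then Y t ω * 2 ^ a (conf t ω) c else 0) ?_ ?_ ?_ k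
  · have hYb : ∫⁻ ω, Y b ω ∂μ = 1 := by
      simp only [hY, Finset.Ico_self, Finset.notMem_empty, false_imp_iff, implies_true, if_true,
        Finset.sum_empty, pow_zero, lintegral_const, measure_univ, mul_one]
    rw [hYb, mul_one] at key
    set z := (3 * k + 4 * y + 3) / 4 with hz
    refine (h.measure_le_of_lintegral_le (hdetY (b + k)) (a := 2 ^ z) ?_ (by positivity) (by simp)
      key).trans ?_
    · rintro ω ⟨h1, h2⟩
      simp only [hY]
      rw [if_pos h1]
      exact pow_le_pow_right₀ one_le_two (by omega)
    · rw [ENNReal.div_le_iff (by positivity) (by simp), ← ENNReal.ofReal_pow (by norm_num),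
        mul_comm, ← div_eq_mul_inv, ENNReal.le_div_iff_mul_le (Or.inl (by positivity))
        (Or.inl (by simp)),
        show (2 : ℝ≥0∞) = ENNReal.ofReal 2 by norm_num, ← ENNReal.ofReal_pow zero_le_two,
        ← ENNReal.ofReal_pow zero_le_two, ← ENNReal.ofReal_mul (by positivity)]
      refine ENNReal.ofReal_le_ofReal ?_
      rw [← pow_le_pow_iff_left₀ (by positivity) (by positivity) (n := 4) (by norm_num)]
      calc (((5 : ℝ) / 3) ^ k * 2 ^ y) ^ 4 = ((5 / 3) ^ 4) ^ k * 2 ^ (4 * y) := by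
            rw [mul_pow, ← pow_mul, ← pow_mul, ← pow_mul, mul_comm k, mul_comm y]
        -- `(5 / 3) ^ 4 < 2 ^ 3`, so growth by `5 / 3` per step is beaten by the rate `3 / 4` in
        -- powers of two.
        _ ≤ 8 ^ k * 2 ^ (4 * y) := by
            refine mul_le_mul_of_nonneg_right (pow_le_pow_left₀ (by norm_num) (by norm_num) _)
              (by positivity)
        _ = 2 ^ (3 * k + 4 * y) := by
            rw [pow_add, pow_mul 2 3 k]; norm_num
        _ ≤ 2 ^ (z * 4) := pow_le_pow_right₀ one_le_two (by omega)
        _ = _ := by rw [pow_mul]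
  · intro t c ω ω' hf hc
    simp only [hf t le_rfl, hdetY t ω ω' hf hc]
  · intro t ω hbt _
    simp only [hY]
    rw [Finset.sum_Ico_succ_top hbt, pow_add]
    by_cases h1 : ∀ τ ∈ Finset.Ico b (t + 1), ok (conf τ ω)
    · rw [if_pos h1, if_pos (h1 t (by simp [hbt])), if_pos]
      intro τ hτ
      rw [Finset.mem_Ico] at hτ
      exact h1 τ (by rw [Finset.mem_Ico]; omega)
    · rw [if_neg h1]; exact zero_le
  · intro t ω hbt
    by_cases h1 : ok (conf t ω)
    · simp only [h1, if_true]
      rw [choiceMean_const_mul, mul_comm]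
      exact mul_le_mul_left (ha _ h1) _
    · simp only [h1, if_false]
      refine le_trans (le_of_eq ?_) zero_le
      simp [choiceMean]

end IsExecution

/-- Lindley's formula. -/
lemma exists_backlog_add_le (a : ℕ → ℕ) {b t : ℕ} (hbt : b ≤ t) :
    ∃ r, b ≤ r ∧ r ≤ t ∧ backlog a t + (t - r) ≤
      ∑ τ ∈ Finset.Ico r t, a τ + if r = b then backlog a b else 0 := by
  induction hbt with
  | refl => exact ⟨b, le_rfl, le_rfl, by simp⟩
  | @step t hbt ih =>
    obtain ⟨r, h1, h2, h3⟩ := ih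
    rcases Nat.eq_zero_or_pos (backlog a t + a t) with h4 | h4
    · refine ⟨t + 1, Nat.le_succ_of_le hbt, le_rfl, ?_⟩
      simp [backlog, h4]
    · refine ⟨r, h1, by omega, ?_⟩
      rw [Finset.sum_Ico_succ_top h2, backlog]
      omega

/-! ### Deterministic bounds on hops, paths and long buffers -/

namespace IsRun
variable [Fintype V] {G : SimpleGraph V} {s : V} {choice : ℕ → V → V}
    {conf : ℕ → Config V} {queue : ℕ → V → List (Msg V)} {Δ N : ℕ}

lemma length_buffer_le_load (h : IsRun G s choice conf queue) (v : V) (t : ℕ) :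
    ((conf t).buffer v).length ≤ load choice v t + ∑ τ ∈ Finset.range t, (conf τ).answers v :=
  (h.length_buffer_le v t).trans (Nat.add_le_add_right
    (backlog_mono (fun τ => (conf τ).requests_le (choice τ) v) t) _)

/-- No copy is on its way to `v` before `v` is reached, and afterwards each neighbor sends at most
one per step. This crude bound is good enough when `Δ ≤ D`. -/
lemma sum_answers_le_mul [DecidableRel G.Adj] (h : IsRun G s choice conf queue)
    (hreg : G.IsRegularOfDegree Δ) (v : V)
    (t : ℕ) : ∑ τ ∈ Finset.range t, (conf τ).answers v ≤ Δ * (t - reachTime conf N v) := by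
  classical
  rcases le_total t (reachTime conf N v) with hle | hle
  · rw [Finset.sum_eq_zero]
    · exact Nat.zero_le _
    · intro τ hτ
      rw [Finset.mem_range] at hτ
      by_contra hne
      obtain ⟨w, hw⟩ := Finset.card_ne_zero.1 hne
      have : (conf τ).Reached v := Or.inr (Or.inr ⟨w, (Finset.mem_filter.1 hw).2⟩)
      have := h.reachTime_le_of_reached (N := N) this
      omega
  · rw [← Finset.sum_range_add_sum_Ico _ hle, Finset.sum_eq_zero, zero_add]
    · calc _ ≤ ∑ τ ∈ Finset.Ico (reachTime conf N v) t, Δ :=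
            Finset.sum_le_sum fun τ _ => (h.answers_le_degree τ v).trans (hreg.degree_eq v).le
        _ = _ := by rw [Finset.sum_const, Nat.card_Ico, smul_eq_mul, mul_comm]
    · intro τ hτ
      rw [Finset.mem_range] at hτ
      by_contra hne
      obtain ⟨w, hw⟩ := Finset.card_ne_zero.1 hne
      have : (conf τ).Reached v := Or.inr (Or.inr ⟨w, (Finset.mem_filter.1 hw).2⟩)
      have := h.reachTime_le_of_reached (N := N) this
      omega

/-- The time that a hop takes, in terms of the gap and of the load at the time of the request. -/
lemma reachTime_le_hop_load [DecidableRel G.Adj] (h : IsRun G s choice conf queue)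
    (hreg : G.IsRegularOfDegree Δ)
    (N : ℕ) (z u : V) :
    reachTime conf N z ≤ reachTime conf N u + (Δ + 1) * (gap conf choice z u N + 1) +
      frozen (Hit conf choice z u) (load choice u) N := by
  set t := reachTime conf N u + gap conf choice z u N + 1 with ht
  by_cases hN : N ≤ t
  · have := reachTime_le conf N z
    have : gap conf choice z u N + 1 ≤ (Δ + 1) * (gap conf choice z u N + 1) :=
      Nat.le_mul_of_pos_left _ (Nat.succ_pos _)
    omega
  · obtain ⟨h1, h2, h3⟩ := h.choice_gap (u := z) (w := u) (N := N) (by omega)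
    -- The hit is first recorded at `t`, one step after the choice, so halting there freezes exactly
    -- the load that the request meets.
    have hf : frozen (Hit conf choice z u) (load choice u) N = load choice u t := by
      refine frozen_of_halt (by omega) (fun τ hτ => h3 τ (by omega)) fun τ hτ => ?_
      exact ⟨_, by omega, ⟨reachTime conf N u, by omega, h.reached_reachTime (by omega)⟩, h2⟩
    have h4 : reachTime conf N z ≤ t + ((conf t).buffer u).length :=
      (h.reachTime_le_hop N z u).resolve_left hN
    have h5 := h.length_buffer_le_load u t
    have h6 := h.sum_answers_le_mul (N := N) hreg u t
    have h7 : t - reachTime conf N u = gap conf choice z u N + 1 := by omega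
    rw [h7] at h6
    rw [hf, add_mul]
    omega

lemma reachTime_path_le [DecidableRel G.Adj] (h : IsRun G s choice conf queue)
    (hreg : G.IsRegularOfDegree Δ)
    (N : ℕ) (p : ℕ → V) (hp : p 0 = s) (l : ℕ) :
    reachTime conf N (p l) ≤ ∑ i ∈ Finset.range l, ((Δ + 1) *
      (gap conf choice (p (i + 1)) (p i) N + 1) +
        frozen (Hit conf choice (p (i + 1)) (p i)) (load choice (p i)) N) := by
  induction l with
  | zero => rw [hp, h.reachTime_source]; exact Nat.zero_le _
  | succ l ih =>
    rw [Finset.sum_range_succ]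
    have := h.reachTime_le_hop_load hreg N (p (l + 1)) (p l)
    omega

lemma informed_of_reachTime (h : IsRun G s choice conf queue) {v : V}
    (hv : reachTime conf N v + 2 + frozen (Armed conf v) (load choice v) N ≤ N) :
    v ∈ (conf N).informed := by
  have hr : (conf (reachTime conf N v)).Reached v := h.reached_reachTime (by omega)
  have hf : ∀ τ < reachTime conf N v, ¬ (conf τ).Reached v := fun τ hτ hr' => by
    have := h.reachTime_le_of_reached (N := N) hr'
    omega
  have h1 : frozen (Armed conf v) (load choice v) N = load choice v (reachTime conf N v + 1) := by
    refine frozen_of_halt (by omega) (fun τ hτ => ?_) fun τ hτ => ⟨_, hτ, hr⟩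
    rintro ⟨τ', h2, h3⟩
    exact hf τ' (by omega) h3
  rw [h1] at hv
  exact h.informed_mono hv (h.informed_of_first_reached hr hf)

/-- A node with a long buffer has a neighbor that was reached much earlier. -/
lemma exists_early_neighbor [DecidableRel G.Adj] (h : IsRun G s choice conf queue) {O y : ℕ}
    (hO : 1 ≤ O) (hy : y ≤ O)
    (hload : ∀ v, ∀ r ≤ N, load choice v r ≤ O)
    (hreq : open Classical in ∀ u b r, b ≤ r → r ≤ N →
      Δ ≤ 2 * ((G.neighborFinset u).filter fun w => w ∈ (conf b).informed).card →
      4 * ∑ τ ∈ Finset.Ico b r, (conf τ).requests (choice τ) u ≤ 3 * (r - b) + 4 * y)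
    (huse : open Classical in ∀ u b r, b ≤ r → r ≤ N →
      (∀ τ ∈ Finset.Ico b r,
        2 * ((G.neighborFinset u).filter fun w => (conf τ).Reached w).card ≤ Δ) →
      4 * ∑ τ ∈ Finset.Ico b r, (conf τ).useful (choice τ) u ≤ 3 * (r - b) + 4 * y)
    {u : V} {t : ℕ} (ht : t ≤ N) (hq : 98 * O ≤ ((conf t).buffer u).length) :
    ∃ w, G.Adj u w ∧ reachTime conf N w + ((conf t).buffer u).length ≤ t + y := by
  classical
  set q := ((conf t).buffer u).length with hqdef
  set B := backlog (fun τ => (conf τ).requests (choice τ) u) with hB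
  set R := fun b r => ∑ τ ∈ Finset.Ico b r, (conf τ).useful (choice τ) u with hR
  have hq' : q ≤ B t + R 0 t := by
    refine (h.length_buffer_le u t).trans (Nat.add_le_add_left ?_ _)
    refine (h.sum_answers_le u t).trans (le_of_eq ?_)
    rw [hR, Finset.range_eq_Ico]
  have hBO : ∀ r ≤ N, B r ≤ O := fun r hr =>
    (backlog_mono (fun τ => (conf τ).requests_le (choice τ) u) r).trans (hload u r hr)
  have hone : ∀ τ, (conf τ).useful (choice τ) u ≤ 1 := by
    intro τ; unfold Config.useful; split_ifs <;> simp
  have hRle : ∀ b r, R b r ≤ r - b := by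
    intro b r
    calc R b r ≤ ∑ τ ∈ Finset.Ico b r, 1 := Finset.sum_le_sum fun τ _ => hone τ
      _ = r - b := by simp
  -- The witness is the neighbor reached first, at time `m`: before `m` no request of `u` is useful,
  -- so at most `t - m` copies can have been delivered to `u`.
  obtain ⟨w, hw, hmin⟩ := Finset.exists_min_image (G.neighborFinset u) (reachTime conf N)
    ⟨choice 0 u, by simpa using h.adj 0 u⟩
  rw [SimpleGraph.mem_neighborFinset] at hw
  refine ⟨w, hw, ?_⟩
  set m := reachTime conf N w with hm
  have hzero : ∀ τ < m, (conf τ).useful (choice τ) u = 0 := by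
    intro τ hτ
    unfold Config.useful
    rw [if_neg]
    rintro ⟨-, hr⟩
    have h1 := h.reachTime_le_of_reached (N := N) hr
    have h2 := hmin (choice τ u) (by simpa using h.adj τ u)
    omega
  have hBt := hBO t ht
  have hRm : R 0 t ≤ R m t := by
    rcases le_total m t with hle | hle
    · simp only [hR]
      rw [← Finset.sum_Ico_consecutive _ (Nat.zero_le m) hle,
        Finset.sum_eq_zero (s := Finset.Ico 0 m), zero_add]
      exact fun τ hτ => hzero τ (Finset.mem_Ico.1 hτ).2
    · simp only [hR]
      rw [Finset.sum_eq_zero (s := Finset.Ico 0 t)]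
      · exact Nat.zero_le _
      · exact fun τ hτ => hzero τ (by have := (Finset.mem_Ico.1 hτ).2; omega)
  have hRt := hRle m t
  have hmt : m + 97 * O ≤ t := by omega
  set g := t - 10 * O with hg
  -- If half of the neighbors are informed by `g`, requests arrive at rate at most `3 / 4`. A
  -- backlog of at most `O` is then cleared within the `10 O` steps before `t`, and Lindley's
  -- formula leaves at most `y` requests.
  by_cases hhalf : Δ ≤ 2 * ((G.neighborFinset u).filter fun w => w ∈ (conf g).informed).card
  · obtain ⟨r, h1, h2, h3⟩ := exists_backlog_add_le
      (fun τ => (conf τ).requests (choice τ) u) (b := g) (t := t) (by omega)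
    have h4 := hreq u r t h2 ht (hhalf.trans (Nat.mul_le_mul_left _ (Finset.card_le_card
      (Finset.monotone_filter_right _ fun w _ hw => h.informed_mono h1 hw))))
    rw [← hB] at h3
    have h5 := hBO g (by omega)
    split_ifs at h3 with h6
    · omega
    · omega
  -- Otherwise at most half of the neighbors were reached before `r`, because reached nodes are
  -- informed within `O + 2` steps. Useful requests then have rate at most `3 / 4` on `[m, r)`, and
  -- the saving `(r - m) / 4` outweighs the backlog `O` of requests, as `r - m` is at least `85 O`.
  · set r := g - O - 1 with hr
    have hreach : ∀ τ < r, 2 * ((G.neighborFinset u).filter fun w => (conf τ).Reached w).card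
        ≤ Δ := by
      intro τ hτ
      have : ((G.neighborFinset u).filter fun w => (conf τ).Reached w).card ≤
          ((G.neighborFinset u).filter fun w => w ∈ (conf g).informed).card := by
        refine Finset.card_le_card (Finset.monotone_filter_right _ fun w _ hw => ?_)
        exact h.informed_mono (by omega)
          (h.informed_of_reached (b := O) (fun τ' hτ' => hload w τ' (by omega)) hw)
      omega
    have hmr : m ≤ r := by
      by_contra hlt
      omega
    have h1 := huse u m r hmr (by omega) fun τ hτ => hreach τ (Finset.mem_Ico.1 hτ).2
    have h2 : R m t = R m r + R r t := (Finset.sum_Ico_consecutive _ hmr (by omega)).symm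
    have h3 := hRle r t
    have h4 : 4 * R m r ≤ 3 * (r - m) + 4 * y := h1
    omega

/-- If the choices are typical, then the rumor crosses every edge quickly. -/
lemma reachTime_le_of_adj [DecidableRel G.Adj] (h : IsRun G s choice conf queue)
    {O y D : ℕ} (hO : 1 ≤ O) (hy : (5 * D + 1) * (y + 2) ≤ O)
    (hload : ∀ v, ∀ r ≤ 500 * D * O, load choice v r ≤ O)
    (hreq : open Classical in ∀ u b r, b ≤ r → r ≤ 500 * D * O →
      Δ ≤ 2 * ((G.neighborFinset u).filter fun w => w ∈ (conf b).informed).card →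
      4 * ∑ τ ∈ Finset.Ico b r, (conf τ).requests (choice τ) u ≤ 3 * (r - b) + 4 * y)
    (huse : open Classical in ∀ u b r, b ≤ r → r ≤ 500 * D * O →
      (∀ τ ∈ Finset.Ico b r,
        2 * ((G.neighborFinset u).filter fun w => (conf τ).Reached w).card ≤ Δ) →
      4 * ∑ τ ∈ Finset.Ico b r, (conf τ).useful (choice τ) u ≤ 3 * (r - b) + 4 * y)
    (hgap : ∀ m ≤ 5 * D + 1, ∀ U : ℕ → V, (∀ j < m, G.Adj (U j) (U (j + 1))) →
      Set.InjOn U (Finset.range (m + 1)) →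
      ∑ j ∈ Finset.range m, gap conf choice (U j) (U (j + 1)) (500 * D * O) ≤ O)
    {z u : V} (hzu : G.Adj z u) :
    reachTime conf (500 * D * O) z ≤ reachTime conf (500 * D * O) u + 200 * O := by
  set N := 500 * D * O with hN
  set S := reachTime conf N with hS
  set g := fun z u => gap conf choice z u N with hg
  have hyO : y ≤ O := le_trans (by nlinarith) hy
  by_contra hlt
  push Not at hlt
  -- Assuming a hop longer than `200 O`, follow slow hops backwards in time. From `S (U m) ≤ t + q`
  -- and `S w + q ≤ t + y`, with `q` the buffer length, the next hop is shorter than the current one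
  -- by at most twice the gap plus `y + 2`. The total loss is at most `3 O`, so each hop stays
  -- longer than `100 O`.
  have key : ∀ m, m ≤ 5 * D → ∃ U : ℕ → V,
      (∀ j < m + 1, G.Adj (U j) (U (j + 1)) ∧ S (U (j + 1)) + 100 * O ≤ S (U j)) ∧
      200 * O + S (U (m + 1)) ≤ S (U m) + 2 * ∑ j ∈ Finset.range m, g (U j) (U (j + 1))
        + m * (y + 2) := by
    intro m
    induction m with
    | zero =>
      intro _
      refine ⟨fun j => if j = 0 then z else u, ?_, ?_⟩
      · intro j hj
        obtain rfl : j = 0 := by omega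
        simp only [if_true, zero_add, one_ne_zero, if_false]
        exact ⟨hzu, by omega⟩
      · simp only [if_true, zero_add, one_ne_zero, if_false]
        simp; omega
    | succ m ih =>
      intro hm
      obtain ⟨U, h1, h2⟩ := ih (by omega)
      have hanti' : ∀ i k, i + k + 1 ≤ m + 1 → S (U (i + k + 1)) < S (U i) := by
        intro i k
        induction k with
        | zero =>
          intro hj
          have := (h1 i (by omega)).2
          simp only [add_zero]
          omega
        | succ k ih =>
          intro hj
          have h3 := (h1 (i + k + 1) (by omega)).2
          have h4 := ih (by omega)
          rw [show i + (k + 1) + 1 = i + k + 1 + 1 by ring]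
          omega
      have hanti : ∀ i j, i < j → j ≤ m + 1 → S (U j) < S (U i) := by
        intro i j hij hj
        have := hanti' i (j - i - 1) (by omega)
        rwa [show i + (j - i - 1) + 1 = j by omega] at this
      -- Reach times strictly decrease along `U`, so the waiting nodes are distinct, as the joint
      -- bound on gaps requires.
      have hinj : Set.InjOn U (Finset.range (m + 1 + 1)) := by
        intro i hi j hj hij
        simp only [Finset.coe_range, Set.mem_Iio] at hi hj
        rcases lt_trichotomy i j with hlt | heq | hgt
        · have := hanti i j hlt (by omega); rw [hij] at this; omega
        · exact heq
        · have := hanti j i hgt (by omega); rw [hij] at this; omega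
      have hsum : ∑ j ∈ Finset.range (m + 1), g (U j) (U (j + 1)) ≤ O :=
        hgap (m + 1) (by omega) U (fun j hj => (h1 j hj).1) hinj
      rw [Finset.sum_range_succ] at hsum
      have hm1 : (m + 1) * (y + 2) ≤ O := le_trans (Nat.mul_le_mul_right _ (by omega)) hy
      have hH := (h1 m (by omega)).2
      set t := S (U (m + 1)) + g (U m) (U (m + 1)) + 1 with ht
      have htN : t < N ∧ S (U m) ≤ t + ((conf t).buffer (U (m + 1))).length := by
        have h2' : N ≤ t ∨ S (U m) ≤ t + ((conf t).buffer (U (m + 1))).length :=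
          h.reachTime_le_hop N (U m) (U (m + 1))
        rcases h2' with h3 | h3
        · exfalso
          have h4 : S (U m) ≤ N := reachTime_le conf N _
          omega
        · by_cases h4 : N ≤ t
          · exfalso
            have h4 : S (U m) ≤ N := reachTime_le conf N _
            omega
          · exact ⟨by omega, h3⟩
      obtain ⟨w, hw, hwq⟩ := h.exists_early_neighbor hO hyO hload hreq huse
        (u := U (m + 1)) (t := t) htN.1.le (by omega)
      have hwq' : S w + ((conf t).buffer (U (m + 1))).length ≤ t + y := hwq
      have hsum2 : 2 * (∑ j ∈ Finset.range (m + 1), g (U j) (U (j + 1))) =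
          2 * (∑ j ∈ Finset.range m, g (U j) (U (j + 1))) + 2 * g (U m) (U (m + 1)) := by
        rw [Finset.sum_range_succ]; ring
      have hmul : (m + 1) * (y + 2) = m * (y + 2) + y + 2 := by ring
      have hnew : 200 * O + S w ≤ S (U (m + 1)) +
          2 * ∑ j ∈ Finset.range (m + 1), g (U j) (U (j + 1)) + (m + 1) * (y + 2) := by
        omega
      have hU : ∀ j ≤ m + 1, Function.update U (m + 1 + 1) w j = U j := fun j hj =>
        Function.update_of_ne (by omega) _ _
      refine ⟨Function.update U (m + 1 + 1) w, fun j hj => ?_, ?_⟩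
      · rcases Nat.lt_succ_iff_lt_or_eq.1 hj with hj' | rfl
        · rw [hU j (by omega), hU (j + 1) (by omega)]
          exact h1 j hj'
        · rw [hU _ le_rfl, Function.update_self]
          refine ⟨hw, ?_⟩
          rw [Finset.sum_range_succ] at hnew
          omega
      · rw [Function.update_self, hU _ le_rfl]
        have : ∑ j ∈ Finset.range (m + 1), g (Function.update U (m + 1 + 1) w j)
            (Function.update U (m + 1 + 1) w (j + 1)) =
            ∑ j ∈ Finset.range (m + 1), g (U j) (U (j + 1)) := by
          refine Finset.sum_congr rfl fun j hj => ?_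
          rw [Finset.mem_range] at hj
          rw [hU j (by omega), hU (j + 1) (by omega)]
        rw [this]
        exact hnew
  obtain ⟨U, h1, -⟩ := key (5 * D) le_rfl
  have hdesc : ∀ j ≤ 5 * D + 1, S (U j) + j * (100 * O) ≤ S (U 0) := by
    intro j
    induction j with
    | zero => simp
    | succ j ih =>
      intro hj
      have := (h1 j (by omega)).2
      have := ih (by omega)
      rw [add_mul]
      omega
  have h3 := hdesc _ le_rfl
  have h4 : S (U 0) ≤ N := reachTime_le conf N _
  have h5 : (5 * D + 1) * (100 * O) = N + 100 * O := by rw [hN]; ring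
  omega

/-- At most `D` hops of at most `200 O` steps reach every node by time `200 D O`. Another `O + 2`
steps suffice to read the rumor, well within the horizon. -/
lemma informed_eq_univ [DecidableRel G.Adj] (h : IsRun G s choice conf queue)
    (hconn : G.Connected) {O y D : ℕ} (hD : 1 ≤ D) (hdist : ∀ v, G.dist s v ≤ D)
    (hO : 1 ≤ O) (hy : (5 * D + 1) * (y + 2) ≤ O)
    (hload : ∀ v, ∀ r ≤ 500 * D * O, load choice v r ≤ O)
    (hreq : open Classical in ∀ u b r, b ≤ r → r ≤ 500 * D * O →
      Δ ≤ 2 * ((G.neighborFinset u).filter fun w => w ∈ (conf b).informed).card →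
      4 * ∑ τ ∈ Finset.Ico b r, (conf τ).requests (choice τ) u ≤ 3 * (r - b) + 4 * y)
    (huse : open Classical in ∀ u b r, b ≤ r → r ≤ 500 * D * O →
      (∀ τ ∈ Finset.Ico b r,
        2 * ((G.neighborFinset u).filter fun w => (conf τ).Reached w).card ≤ Δ) →
      4 * ∑ τ ∈ Finset.Ico b r, (conf τ).useful (choice τ) u ≤ 3 * (r - b) + 4 * y)
    (hgap : ∀ m ≤ 5 * D + 1, ∀ U : ℕ → V, (∀ j < m, G.Adj (U j) (U (j + 1))) →
      Set.InjOn U (Finset.range (m + 1)) →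
      ∑ j ∈ Finset.range m, gap conf choice (U j) (U (j + 1)) (500 * D * O) ≤ O) :
    (conf (500 * D * O)).informed = Set.univ := by
  refine Set.eq_univ_of_forall fun v => ?_
  have hwalk : ∀ {u v : V} (p : G.Walk u v), reachTime conf (500 * D * O) u ≤
      reachTime conf (500 * D * O) v + p.length * (200 * O) := by
    intro u v p
    induction p with
    | nil => simp
    | cons hadj p ih =>
      have := h.reachTime_le_of_adj hO hy hload hreq huse hgap hadj
      rw [SimpleGraph.Walk.length_cons, add_mul]
      omega
  obtain ⟨p, hp⟩ := hconn.exists_walk_length_eq_dist v s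
  have h1 := hwalk p
  rw [h.reachTime_source, hp, zero_add, G.dist_comm] at h1
  have h2 : G.dist s v * (200 * O) ≤ D * (200 * O) := Nat.mul_le_mul_right _ (hdist v)
  have hDO : 1 ≤ D * O := Nat.mul_pos hD hO
  have hOD : O ≤ D * O := Nat.le_mul_of_pos_left _ hD
  have e1 : D * (200 * O) = 200 * (D * O) := by ring
  have e2 : 500 * D * O = 500 * (D * O) := by ring
  refine h.informed_mono ?_ (h.informed_of_reached (b := O)
    (t := reachTime conf (500 * D * O) v) (fun τ hτ => hload v τ (by omega))
    (h.reached_reachTime (by omega)))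
  omega

end IsRun

/-! ### Union bounds in powers of two -/

lemma two_pow_mul_inv_le {a b c : ℕ} (h : a + c ≤ b) :
    (2 : ℝ≥0∞) ^ a * (2 ^ b)⁻¹ ≤ (2 ^ c)⁻¹ := by
  rw [← ENNReal.div_eq_inv_mul.trans (mul_comm _ _), ENNReal.div_le_iff (by positivity) (by simp),
    mul_comm, ← div_eq_mul_inv, ENNReal.le_div_iff_mul_le (Or.inl (by positivity))
    (Or.inl (by simp)), ← pow_add]
  exact pow_le_pow_right₀ one_le_two h

lemma ofReal_exp_le {x : ℝ} {n : ℕ} (hx : x ≤ -n) :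
    ENNReal.ofReal (Real.exp x) ≤ (2 ^ n)⁻¹ := by
  have h1 : Real.exp x ≤ (2 ^ n)⁻¹ := by
    refine (Real.exp_le_exp.2 hx).trans ?_
    rw [Real.exp_neg, ← Real.exp_one_pow]
    refine inv_anti₀ (by positivity) (pow_le_pow_left₀ zero_le_two ?_ n)
    have := Real.add_one_le_exp 1
    linarith
  refine (ENNReal.ofReal_le_ofReal h1).trans (le_of_eq ?_)
  rw [ENNReal.ofReal_inv_of_pos (by positivity), ENNReal.ofReal_pow zero_le_two]
  norm_num

lemma measure_iUnion_le_card {Ω ι : Type*} [MeasurableSpace Ω] (μ : Measure Ω) (J : Finset ι)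
    (A : ι → Set Ω) {a n : ℕ} {p : ℝ≥0∞} (hJ : J.card ≤ 2 ^ a) (hA : ∀ i ∈ J, μ (A i) ≤ p)
    (hp : p ≤ (2 ^ n)⁻¹) {c : ℕ} (hc : a + c ≤ n) : μ (⋃ i ∈ J, A i) ≤ (2 ^ c)⁻¹ := by
  refine (measure_biUnion_finset_le J A).trans ((Finset.sum_le_sum hA).trans ?_)
  rw [Finset.sum_const, nsmul_eq_mul]
  refine (mul_le_mul' (?_ : (J.card : ℝ≥0∞) ≤ 2 ^ a) hp).trans (two_pow_mul_inv_le hc)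
  exact_mod_cast hJ

/-! ### Size of the graph and geodesics -/

section graph
variable {G : SimpleGraph V} {s : V}

lemma exists_parent (hconn : G.Connected) (s : V) :
    ∃ par : V → V, ∀ v, v ≠ s → G.Adj v (par v) ∧ G.dist s v = G.dist s (par v) + 1 := by
  have key : ∀ v, ∃ w, v ≠ s → G.Adj v w ∧ G.dist s v = G.dist s w + 1 := by
    intro v
    obtain ⟨p, hp⟩ := hconn.exists_walk_length_eq_dist v s
    cases p with
    | nil => exact ⟨s, fun h => absurd rfl h⟩
    | @cons _ w _ hadj p =>
      refine ⟨w, fun _ => ⟨hadj, ?_⟩⟩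
      rw [SimpleGraph.Walk.length_cons] at hp
      have h1 := SimpleGraph.dist_le p
      have h2 := hconn.dist_triangle (u := v) (v := w) (w := s)
      rw [SimpleGraph.dist_eq_one_iff_adj.2 hadj] at h2
      rw [G.dist_comm (u := s), G.dist_comm (u := s)]
      omega
  choose par hpar using key
  exact ⟨par, hpar⟩

/-- The number of vertices of a regular graph of bounded diameter. -/
lemma card_le_pow [Fintype V] [DecidableRel G.Adj] {Δ D : ℕ} (hconn : G.Connected)
    (hreg : G.IsRegularOfDegree Δ) (hdist : ∀ v, G.dist s v ≤ D) :
    Fintype.card V ≤ (Δ + 1) ^ D := by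
  classical
  obtain ⟨par, hpar⟩ := exists_parent hconn s
  have key : ∀ k, (Finset.univ.filter fun v => G.dist s v ≤ k).card ≤ (Δ + 1) ^ k := by
    intro k
    induction k with
    | zero =>
      rw [pow_zero, Finset.card_le_one]
      intro a ha b hb
      simp only [Finset.mem_filter, Finset.mem_univ, true_and, Nat.le_zero,
        hconn.dist_eq_zero_iff] at ha hb
      rw [← ha, ← hb]
    | succ k ih =>
      have hsub : (Finset.univ.filter fun v => G.dist s v ≤ k + 1) ⊆
          (Finset.univ.filter fun v => G.dist s v ≤ k).biUnion
            fun v => insert v (G.neighborFinset v) := by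
        intro v hv
        simp only [Finset.mem_filter, Finset.mem_univ, true_and] at hv
        simp only [Finset.mem_biUnion, Finset.mem_filter, Finset.mem_univ, true_and,
          Finset.mem_insert, SimpleGraph.mem_neighborFinset]
        by_cases hvs : v = s
        · exact ⟨v, by simp [hvs], Or.inl rfl⟩
        · obtain ⟨h1, h2⟩ := hpar v hvs
          exact ⟨par v, by omega, Or.inr h1.symm⟩
      calc _ ≤ _ := Finset.card_le_card hsub
        _ ≤ _ := Finset.card_biUnion_le_card_mul _ _ (Δ + 1) fun v _ => by
            refine (Finset.card_insert_le _ _).trans ?_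
            rw [SimpleGraph.card_neighborFinset_eq_degree, hreg.degree_eq]
        _ ≤ (Δ + 1) ^ k * (Δ + 1) := Nat.mul_le_mul_right _ ih
        _ = _ := (pow_succ _ _).symm
  have := key D
  rwa [Finset.filter_true_of_mem fun v _ => hdist v, Finset.card_univ] at this

/-- A shortest path from `s` to `v`. -/
lemma exists_geodesic (hconn : G.Connected) (s v : V) :
    ∃ (p : ℕ → V) (par : V → V), p 0 = s ∧ p (G.dist s v) = v ∧
      (∀ i ≤ G.dist s v, G.dist s (p i) = i) ∧
      ∀ i < G.dist s v, G.Adj (p (i + 1)) (p i) ∧ par (p (i + 1)) = p i := by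
  obtain ⟨par, hpar⟩ := exists_parent hconn s
  have hd : ∀ k ≤ G.dist s v, G.dist s (par^[k] v) + k = G.dist s v := by
    intro k
    induction k with
    | zero => simp
    | succ k ih =>
      intro hk
      have h1 := ih (by omega)
      have hne : par^[k] v ≠ s := by
        intro he
        rw [he, SimpleGraph.dist_self] at h1
        omega
      have h2 := (hpar _ hne).2
      rw [Function.iterate_succ_apply']
      omega
  have hstep : ∀ i < G.dist s v, par^[G.dist s v - i] v = par (par^[G.dist s v - (i + 1)] v) := by
    intro i hi
    rw [← Function.iterate_succ_apply' par]
    congr 2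
    omega
  refine ⟨fun i => par^[G.dist s v - i] v, par, ?_, by simp, ?_, ?_⟩
  · have := hd (G.dist s v) le_rfl
    exact ((hconn.dist_eq_zero_iff).1 (by simpa using this)).symm
  · intro i hi
    have := hd (G.dist s v - i) (by omega)
    simp only
    omega
  · intro i hi
    simp only
    rw [hstep i hi]
    refine ⟨(hpar _ fun he => ?_).1, rfl⟩
    have := hd (G.dist s v - (i + 1)) (by omega)
    rw [he, SimpleGraph.dist_self] at this
    omega

end graph

lemma determined_hit {Ω : Type*} {choice : ℕ → Ω → V → V} {conf : ℕ → Ω → Config V} (u w : V)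
    (t : ℕ) : Determined choice conf t
      fun ω => Hit (fun τ => conf τ ω) (fun τ => choice τ ω) u w t :=
  fun _ _ hf hc => propext (hit_congr (fun i hi => hf i hi.le) hc u w)

lemma determined_armed {Ω : Type*} {choice : ℕ → Ω → V → V} {conf : ℕ → Ω → Config V} (w : V)
    (t : ℕ) : Determined choice conf t fun ω => Armed (fun τ => conf τ ω) w t :=
  fun _ _ hf _ => propext (armed_congr (fun i hi => hf i (le_of_lt hi)) w)

/-! ### Small degree: `Δ ≤ D` -/

namespace IsExecution
variable [Fintype V] {G : SimpleGraph V} [DecidableRel G.Adj] {s : V} {Δ D Λ : ℕ}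
    {Ω : Type*} [mΩ : MeasurableSpace Ω] {μ : Measure Ω}
    {ℱ : Filtration ℕ mΩ} {choice : ℕ → Ω → V → V} {conf : ℕ → Ω → Config V}

lemma exists_isRun (h : IsExecution G s μ ℱ choice conf) {ω : Ω}
    (hω : ∀ t v, G.Adj v (choice t ω v)) :
    ∃ queue, IsRun G s (fun t => choice t ω) (fun t => conf t ω) queue :=
  BufferPull.exists_isRun (h.init ω) hω fun t => h.step t ω

variable [IsProbabilityMeasure μ]

/-- The probability that `v` is informed late, in graphs of small degree. -/
lemma measure_not_informed_le (h : IsExecution G s μ ℱ choice conf) (hΔ : 0 < Δ)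
    (hreg : G.IsRegularOfDegree Δ) (hconn : G.Connected) (hdist : ∀ v, G.dist s v ≤ D)
    (hΔD : Δ ≤ D) (hDΛ : D ≤ Λ) (v : V) :
    μ {ω | (∀ t v, G.Adj v (choice t ω v)) ∧ v ∉ (conf (1280 * D * Δ * Λ) ω).informed} ≤
      (2 ^ (3 * Λ))⁻¹ := by
  classical
  obtain ⟨p, par, hp0, hpv, hpd, hpar⟩ := exists_geodesic hconn s v
  set l := G.dist s v with hl
  have hlD : l ≤ D := hdist v
  set N := 1280 * D * Δ * Λ with hN
  have hDpos : 0 < D := by omega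
  have hinj : Set.InjOn p (Finset.range (l + 1)) := by
    intro i hi j hj hij
    simp only [Finset.coe_range, Set.mem_Iio] at hi hj
    rw [← hpd i (by omega), ← hpd j (by omega), hij]
  have hinj' : Set.InjOn (fun i => p (i + 1)) (Finset.range l) := by
    intro i hi j hj hij
    simp only [Finset.coe_range, Set.mem_Iio] at hi hj
    have := hinj (by simpa using hi) (by simpa using hj) hij
    omega
  set I := (Finset.range (l + 1)).image p with hI
  set I' := (Finset.range l).image fun i => p (i + 1) with hI'
  have hIcard : I.card ≤ l + 1 := Finset.card_image_le.trans (by simp)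
  have hIcard' : I'.card ≤ l := Finset.card_image_le.trans (by simp)
  -- A node of the path is halted when its successor's request meets its buffer, and the endpoint
  -- `v` just after it is reached. As `p i` is at distance `i`, the successor of `x` is `p (G.dist s
  -- x + 1)`.
  set halt : V → ℕ → Ω → Prop := fun x t ω =>
    if x = v then Armed (fun τ => conf τ ω) v t
    else Hit (fun τ => conf τ ω) (fun τ => choice τ ω) (p (G.dist s x + 1)) x t with hhalt
  have hdet : ∀ i t, Determined choice conf t (halt i t) := by
    intro i t ω ω' hf hc
    simp only [hhalt]
    split_ifs
    · exact determined_armed v t ω ω' hf hc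
    · exact determined_hit _ i t ω ω' hf hc
  have hmono : ∀ i ω t, halt i t ω → halt i (t + 1) ω := by
    intro i ω t
    simp only [hhalt]
    split_ifs
    · rintro ⟨τ, h1, h2⟩; exact ⟨τ, by omega, h2⟩
    · exact fun h1 => (hit_succ _ _ _ _ _).2 (Or.inl h1)
  -- `z = N / 4`. With `θ = 1 / (16 D)` and at most `2 D` nodes, the exponent is at most `10 Δ Λ -
  -- 20 Δ Λ`. The gaps contribute at most `22 D Δ Λ` to the total time.
  set z := 320 * D * Δ * Λ with hz
  have hgap := h.measure_sum_gap_le hΔ hreg I' par (by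
    intro u hu
    obtain ⟨i, hi, rfl⟩ := Finset.mem_image.1 hu
    rw [Finset.mem_range] at hi
    rw [(hpar i hi).2]; exact (hpar i hi).1) N (5 * Λ)
  have hD' : (0 : ℝ) < D := by exact_mod_cast hDpos
  have hload := h.measure_sum_frozen_le hΔ hreg (θ := 1 / (16 * D)) (by positivity) (by
    rw [div_le_one (by positivity)]
    have : (1 : ℝ) ≤ D := by exact_mod_cast hDpos
    linarith) I halt hdet hmono N z
  have hcover : {ω | (∀ t v, G.Adj v (choice t ω v)) ∧ v ∉ (conf N ω).informed} ⊆
      {ω | 2 * Δ * (5 * Λ) ≤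
        ∑ u ∈ I', gap (fun τ => conf τ ω) (fun τ => choice τ ω) u (par u) N} ∪
      {ω | z ≤ ∑ i ∈ I, frozen (fun τ => halt i τ ω) (load (fun τ => choice τ ω) i) N} := by
    rintro ω ⟨hadj, hv⟩
    by_contra hno
    simp only [Set.mem_union, Set.mem_ofPred_eq, not_or, not_le] at hno
    obtain ⟨h1, h2⟩ := hno
    apply hv
    obtain ⟨queue, hrun⟩ := h.exists_isRun hadj
    rw [hI', Finset.sum_image hinj'] at h1
    rw [hI, Finset.sum_image hinj, Finset.sum_range_succ] at h2
    have h3 := hrun.reachTime_path_le hreg N p hp0 l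
    rw [hpv] at h3 h2
    refine hrun.informed_of_reachTime ?_
    have e1 : ∑ i ∈ Finset.range l, gap (fun τ => conf τ ω) (fun τ => choice τ ω)
        (p (i + 1)) (par (p (i + 1))) N = ∑ i ∈ Finset.range l,
          gap (fun τ => conf τ ω) (fun τ => choice τ ω) (p (i + 1)) (p i) N :=
      Finset.sum_congr rfl fun i hi => by rw [(hpar i (Finset.mem_range.1 hi)).2]
    have e2 : ∑ i ∈ Finset.range l, frozen (fun τ => halt (p i) τ ω)
        (load (fun τ => choice τ ω) (p i)) N = ∑ i ∈ Finset.range l,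
          frozen (Hit (fun τ => conf τ ω) (fun τ => choice τ ω) (p (i + 1)) (p i))
            (load (fun τ => choice τ ω) (p i)) N := by
      refine Finset.sum_congr rfl fun i hi => ?_
      rw [Finset.mem_range] at hi
      have hne : p i ≠ v := fun he => by
        have := hpd i hi.le
        rw [he] at this
        omega
      simp only [hhalt, if_neg hne, hpd i hi.le]
    have e3 : frozen (fun τ => halt v τ ω) (load (fun τ => choice τ ω) v) N =
        frozen (Armed (fun τ => conf τ ω) v) (load (fun τ => choice τ ω) v) N := by
      simp only [hhalt, if_true]
    rw [e1] at h1
    rw [e2, e3] at h2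
    rw [Finset.sum_add_distrib, ← Finset.mul_sum, Finset.sum_add_distrib, Finset.sum_const,
      Finset.card_range, smul_eq_mul, mul_one] at h3
    have h4 : (Δ + 1) * (∑ i ∈ Finset.range l, gap (fun τ => conf τ ω) (fun τ => choice τ ω)
        (p (i + 1)) (p i) N + l) ≤ 2 * Δ * (11 * (D * Λ)) := by
      refine Nat.mul_le_mul (by omega) ?_
      have h5 : Δ * Λ ≤ D * Λ := Nat.mul_le_mul_right _ hΔD
      have h6 : D ≤ D * Λ := Nat.le_mul_of_pos_right _ (by omega)
      have h7 : 2 * Δ * (5 * Λ) = 10 * (Δ * Λ) := by ring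
      omega
    have h8 : 2 * Δ * (11 * (D * Λ)) = 22 * (D * Δ * Λ) := by ring
    have h9 : 0 < D * Δ * Λ := by
      have : 0 < Λ := by omega
      positivity
    have h10 : N = 1280 * (D * Δ * Λ) := by rw [hN]; ring
    have h11 : z = 320 * (D * Δ * Λ) := by rw [hz]; ring
    omega
  refine (measure_mono hcover).trans ((measure_union_le _ _).trans
    ((add_le_add (hgap.trans ?_) (hload.trans ?_)).trans
      (?_ : ((2 : ℝ≥0∞) ^ (4 * Λ))⁻¹ + (2 ^ (4 * Λ))⁻¹ ≤ _)))
  · rw [div_eq_mul_inv]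
    exact two_pow_mul_inv_le (by omega)
  · have hexp : (1 / (16 * D : ℝ)) ^ 2 * I.card * N - 1 / (16 * D) * z ≤ -(10 * Λ : ℕ) := by
      have h1 : (I.card : ℝ) ≤ 2 * D := by
        have : I.card ≤ 2 * D := by omega
        exact_mod_cast this
      have h2 : (1 / (16 * D : ℝ)) ^ 2 * I.card * N ≤ (1 / (16 * D : ℝ)) ^ 2 * (2 * D) * N := by
        gcongr
      have h3 : (1 / (16 * D : ℝ)) ^ 2 * (2 * D) * N - 1 / (16 * D) * z = -(10 * Δ * Λ) := by
        rw [hN, hz]; push_cast; field_simp; ring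
      have h4 : (1 : ℝ) ≤ Δ := by exact_mod_cast hΔ
      have h5 : (0 : ℝ) ≤ Λ := Nat.cast_nonneg _
      push_cast
      nlinarith
    refine (mul_le_mul_right (ofReal_exp_le hexp) _).trans (two_pow_mul_inv_le ?_)
    omega
  · rw [← two_mul]
    have := two_pow_mul_inv_le (a := 1) (b := 4 * Λ) (c := 3 * Λ) (by omega)
    rwa [pow_one] at this

lemma measure_late_le_of_degree_le (h : IsExecution G s μ ℱ choice conf) (hΔ : 0 < Δ)
    (hreg : G.IsRegularOfDegree Δ) (hconn : G.Connected) (hdist : ∀ v, G.dist s v ≤ D)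
    (hΔD : Δ ≤ D) (hDΛ : D ≤ Λ) (hcard : Fintype.card V ≤ 2 ^ Λ) :
    μ {ω | (∀ t v, G.Adj v (choice t ω v)) ∧ (conf (1280 * D * Δ * Λ) ω).informed ≠ Set.univ} ≤
      (2 ^ Λ)⁻¹ := by
  refine (measure_mono ?_).trans (measure_iUnion_le_card μ Finset.univ
    (fun v => {ω | (∀ t v, G.Adj v (choice t ω v)) ∧ v ∉ (conf (1280 * D * Δ * Λ) ω).informed})
    (a := Λ) (n := 3 * Λ) (c := Λ) hcard
    (fun v _ => h.measure_not_informed_le hΔ hreg hconn hdist hΔD hDΛ v) le_rfl (by omega))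
  rintro ω ⟨h1, h2⟩
  rw [Set.ne_univ_iff_exists_notMem] at h2
  obtain ⟨v, hv⟩ := h2
  simp only [Finset.mem_univ, Set.iUnion_true, Set.mem_iUnion]
  exact ⟨v, h1, hv⟩

end IsExecution

/-! ### Large degree: `D ≤ Δ` -/

/-- The walk from `z` that in step `j` takes the edge with label `a j`. -/
def labelWalk {Δ M : ℕ} (nbr : V → Fin Δ → V) (z : V) (a : Fin M → Fin Δ) : ℕ → V
  | 0 => z
  | j + 1 => if h : j < M then nbr (labelWalk nbr z a j) (a ⟨j, h⟩) else labelWalk nbr z a j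

lemma exists_labels [Fintype V] (G : SimpleGraph V) [DecidableRel G.Adj] {Δ : ℕ}
    (hreg : G.IsRegularOfDegree Δ) : ∃ nbr : V → Fin Δ → V, ∀ v w, G.Adj v w → ∃ i, nbr v i = w := by
  have hcard : ∀ v, (G.neighborFinset v).card = Δ := fun v => by
    rw [SimpleGraph.card_neighborFinset_eq_degree, hreg.degree_eq]
  refine ⟨fun v i => ((G.neighborFinset v).equivFinOfCardEq (hcard v)).symm i, fun v w hvw => ?_⟩
  exact ⟨(G.neighborFinset v).equivFinOfCardEq (hcard v) ⟨w, by simpa using hvw⟩, by simp⟩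

lemma exists_labelWalk_eq {G : SimpleGraph V} {Δ M m : ℕ} (hΔ : 0 < Δ) {nbr : V → Fin Δ → V}
    (hnbr : ∀ v w, G.Adj v w → ∃ i, nbr v i = w) (hm : m ≤ M) (U : ℕ → V)
    (hU : ∀ j < m, G.Adj (U j) (U (j + 1))) :
    ∃ a : Fin M → Fin Δ, ∀ j ≤ m, labelWalk nbr (U 0) a j = U j := by
  have : ∀ j, ∃ i, j < m → nbr (U j) i = U (j + 1) := by
    intro j
    by_cases hj : j < m
    · obtain ⟨i, hi⟩ := hnbr _ _ (hU j hj)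
      exact ⟨i, fun _ => hi⟩
    · exact ⟨⟨0, hΔ⟩, fun h => absurd h hj⟩
  choose b hb using this
  refine ⟨fun j => b j, fun j => ?_⟩
  induction j with
  | zero => intro _; rfl
  | succ j ih =>
    intro hj
    rw [labelWalk, dif_pos (by omega), ih (by omega)]
    exact hb j (by omega)

namespace IsExecution
variable [Fintype V] {G : SimpleGraph V} [DecidableRel G.Adj] {s : V} {Δ D Λ : ℕ}
    {Ω : Type*} [mΩ : MeasurableSpace Ω] {μ : Measure Ω} [IsProbabilityMeasure μ]
    {ℱ : Filtration ℕ mΩ} {choice : ℕ → Ω → V → V} {conf : ℕ → Ω → Config V}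

lemma measure_walk_gap_le (h : IsExecution G s μ ℱ choice conf) (hΔ : 0 < Δ)
    (hreg : G.IsRegularOfDegree Δ) (W : ℕ → V) (m N k : ℕ)
    (hadj : ∀ j < m, G.Adj (W j) (W (j + 1))) (hinj : Set.InjOn W (Finset.range (m + 1))) :
    μ {ω | 2 * Δ * k ≤ ∑ j ∈ Finset.range m,
      gap (fun τ => conf τ ω) (fun τ => choice τ ω) (W j) (W (j + 1)) N} ≤ 2 ^ m * (2 ^ k)⁻¹ := by
  classical
  have hinj' : Set.InjOn W (Finset.range m) := hinj.mono (by
    intro j hj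
    simp only [Finset.coe_range, Set.mem_Iio] at hj ⊢
    omega)
  have hnxt : ∃ nxt : V → V, ∀ j < m, nxt (W j) = W (j + 1) := by
    refine ⟨fun v => W (Function.invFunOn W (Finset.range m) v + 1), fun j hj => ?_⟩
    simp only
    rw [hinj'.leftInvOn_invFunOn (by simpa using hj)]
  obtain ⟨nxt, hnxt⟩ := hnxt
  have h1 := h.measure_sum_gap_le hΔ hreg ((Finset.range m).image W) nxt (by
    intro u hu
    obtain ⟨j, hj, rfl⟩ := Finset.mem_image.1 hu
    rw [Finset.mem_range] at hj
    rw [hnxt j hj]; exact hadj j hj) N k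
  refine le_trans (measure_mono fun ω hω => ?_) (h1.trans ?_)
  · rw [Set.mem_ofPred_eq, Finset.sum_image hinj']
    refine le_of_le_of_eq (show _ ≤ _ from hω) (Finset.sum_congr rfl fun j hj => ?_)
    rw [hnxt j (Finset.mem_range.1 hj)]
  · rw [div_eq_mul_inv]
    refine mul_le_mul_left (pow_le_pow_right₀ one_le_two ?_) _
    exact Finset.card_image_le.trans (by simp)

lemma measure_load_gt_le (h : IsExecution G s μ ℱ choice conf) (hΔ : 0 < Δ)
    (hreg : G.IsRegularOfDegree Δ) {θ : ℝ} (h0 : 0 ≤ θ) (h1 : θ ≤ 1) (v : V) (t z : ℕ) :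
    μ {ω | z ≤ load (fun τ => choice τ ω) v t} ≤
      2 * ENNReal.ofReal (Real.exp (θ ^ 2 * t - θ * z)) := by
  have h2 := h.measure_sum_frozen_le hΔ hreg h0 h1 {v} (fun _ _ _ => False)
    (fun _ _ _ _ _ _ => rfl) (fun _ _ _ => id) t z
  have h3 : ∀ q : ℕ → ℕ, frozen (fun _ => False) q t = q t := fun q =>
    frozen_of_not_halt fun _ _ => id
  simpa [h3] using h2

/-- The probability that some node is informed late, in graphs of large degree. -/
lemma measure_late_le_of_le_degree (h : IsExecution G s μ ℱ choice conf) (hΔ : 0 < Δ)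
    (hreg : G.IsRegularOfDegree Δ) (hconn : G.Connected) (hdist : ∀ v, G.dist s v ≤ D)
    (hD : 0 < D) (hDΔ : D ≤ Δ) (hDΛ : D ≤ Λ) (hΔΛ : (Δ + 1) ^ D ≤ 2 ^ Λ) :
    μ {ω | (∀ t v, G.Adj v (choice t ω v)) ∧
      (conf (60000000 * D * Δ * Λ) ω).informed ≠ Set.univ} ≤ (2 ^ Λ)⁻¹ := by
  classical
  have hdeg : ∀ v, 0 < G.degree v := fun v => by rw [hreg.degree_eq]; exact hΔ
  have hcard : Fintype.card V ≤ 2 ^ Λ := (card_le_pow hconn hreg hdist).trans hΔΛ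
  have hΛ : 0 < Λ := by omega
  -- `O` bounds the loads up to time `N`: `θ = 1 / (1000 D)` gives the exponent `-60 Λ Δ / D`, at
  -- most `-60 Λ` because `D ≤ Δ`. The slack `y` must beat a union over a node and two times, at
  -- most `2 ^ (59 Λ)` events.
  set O := 120000 * Δ * Λ with hO
  set y := 70 * Λ with hy
  set N := 500 * D * O with hN
  set M := 5 * D + 1 with hM
  have hN' : 60000000 * D * Δ * Λ = N := by rw [hN, hO]; ring
  have hD2 : D ≤ 2 ^ Λ := hDΛ.trans Nat.lt_two_pow_self.le
  have hΔ2 : Δ ≤ 2 ^ Λ := by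
    refine le_trans ?_ hΔΛ
    exact (Nat.le_succ Δ).trans (Nat.le_self_pow hD.ne' _)
  have hN2 : N + 1 ≤ 2 ^ (29 * Λ) := by
    have e1 : N + 1 ≤ 2 ^ 26 * (D * Δ * Λ) := by
      have : 0 < D * Δ * Λ := by positivity
      rw [← hN', show 60000000 * D * Δ * Λ = 60000000 * (D * Δ * Λ) by ring]
      norm_num
      omega
    have e2 : D * Δ * Λ ≤ 2 ^ Λ * 2 ^ Λ * 2 ^ Λ :=
      Nat.mul_le_mul (Nat.mul_le_mul hD2 hΔ2) Nat.lt_two_pow_self.le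
    calc N + 1 ≤ 2 ^ 26 * (2 ^ Λ * 2 ^ Λ * 2 ^ Λ) := e1.trans (Nat.mul_le_mul_left _ e2)
      _ = 2 ^ (26 + (Λ + Λ + Λ)) := by rw [← pow_add, ← pow_add, ← pow_add]
      _ ≤ 2 ^ (29 * Λ) := Nat.pow_le_pow_right (by norm_num) (by omega)
  set T := Finset.range (N + 1) with hT
  have hTcard : T.card ≤ 2 ^ (29 * Λ) := by rw [hT, Finset.card_range]; exact hN2
  -- loads
  have hload : μ (⋃ i ∈ (Finset.univ : Finset V) ×ˢ T,
      {ω | O + 1 ≤ load (fun τ => choice τ ω) i.1 i.2}) ≤ (2 ^ (3 * Λ))⁻¹ := by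
    refine measure_iUnion_le_card μ _ _ (a := 30 * Λ) (n := 59 * Λ) (p := (2 ^ (59 * Λ))⁻¹) ?_ ?_
      le_rfl (by omega)
    · rw [Finset.card_product, Finset.card_univ]
      calc _ ≤ 2 ^ Λ * 2 ^ (29 * Λ) := Nat.mul_le_mul hcard hTcard
        _ = 2 ^ (30 * Λ) := by rw [← pow_add]; congr 1; ring
    · rintro ⟨v, r⟩ hvr
      have hr : r ≤ N := by
        have := (Finset.mem_product.1 hvr).2
        rw [hT, Finset.mem_range] at this
        simp only at this
        omega
      have hD' : (0 : ℝ) < D := by exact_mod_cast hD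
      have hD1 : (1 : ℝ) ≤ D := by exact_mod_cast hD
      have hθ : (1 / (1000 * D) : ℝ) ^ 2 * r - 1 / (1000 * D) * (O + 1 : ℕ) ≤ -(60 * Λ : ℕ) := by
        have e1 : (1 / (1000 * D) : ℝ) ^ 2 * r ≤ (1 / (1000 * D) : ℝ) ^ 2 * N := by
          have : (r : ℝ) ≤ N := by exact_mod_cast hr
          gcongr
        have e2 : (1 / (1000 * D) : ℝ) * O ≤ 1 / (1000 * D) * (O + 1 : ℕ) := by
          push_cast
          gcongr
          linarith
        have e3 : (1 / (1000 * D) : ℝ) ^ 2 * N - 1 / (1000 * D) * O = -(60 * Λ * (Δ / D)) := by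
          rw [hN, hO]; push_cast; field_simp; ring
        have e4 : (1 : ℝ) ≤ Δ / D := by
          rw [le_div_iff₀ hD', one_mul]; exact_mod_cast hDΔ
        have e5 : (60 * Λ : ℝ) ≤ 60 * Λ * (Δ / D) := le_mul_of_one_le_right (by positivity) e4
        push_cast at e2 ⊢
        linarith
      refine (h.measure_load_gt_le hΔ hreg (θ := 1 / (1000 * D)) (by positivity) (by
        rw [div_le_one (by positivity)]; linarith) v r (O + 1)).trans ?_
      refine (mul_le_mul_right (ofReal_exp_le hθ) _).trans ?_
      have := two_pow_mul_inv_le (a := 1) (b := 60 * Λ) (c := 59 * Λ) (by omega)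
      rwa [pow_one] at this
  -- increments
  have hinc : ∀ (ok : V → Config V → Prop) (f : V → Config V → (V → V) → ℕ),
      (∀ u σ, ok u σ → choiceMean G (fun c => 2 ^ f u σ c) ≤ ENNReal.ofReal (5 / 3)) →
      μ (⋃ i ∈ (Finset.univ : Finset V) ×ˢ T ×ˢ T,
        {ω | (∀ τ ∈ Finset.Ico i.2.1 (i.2.1 + i.2.2), ok i.1 (conf τ ω)) ∧
          3 * i.2.2 + 4 * y < 4 * ∑ τ ∈ Finset.Ico i.2.1 (i.2.1 + i.2.2),
            f i.1 (conf τ ω) (choice τ ω)}) ≤ (2 ^ (3 * Λ))⁻¹ := by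
    intro ok f hf
    refine measure_iUnion_le_card μ _ _ (a := 59 * Λ) (n := y) (p := (2 ^ y)⁻¹) ?_ ?_
      le_rfl (by omega)
    · rw [Finset.card_product, Finset.card_product, Finset.card_univ]
      calc _ ≤ 2 ^ Λ * (2 ^ (29 * Λ) * 2 ^ (29 * Λ)) :=
            Nat.mul_le_mul hcard (Nat.mul_le_mul hTcard hTcard)
        _ = 2 ^ (59 * Λ) := by rw [← pow_add, ← pow_add]; congr 1; ring
    · rintro ⟨u, b, k⟩ -
      exact h.measure_sum_increments_le hdeg (ok u) (f u) (hf u) b k y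
  have hreq := hinc
    (fun u σ => Δ ≤ 2 * ((G.neighborFinset u).filter fun w => w ∈ σ.informed).card)
    (fun u σ c => σ.requests c u) fun u σ hσ => mean_requests_le G hΔ hreg σ u hσ
  have huse := hinc
    (fun u σ => 2 * ((G.neighborFinset u).filter fun w => σ.Reached w).card ≤ Δ)
    (fun u σ c => σ.useful c u) fun u σ hσ => mean_useful_le G hΔ hreg σ u hσ
  -- walks
  obtain ⟨nbr, hnbr⟩ := exists_labels G hreg
  -- The path of slow hops depends on the run, so the bound is taken over all walks. Their number is
  -- only exponential in `Λ`, because `Δ ^ D ≤ 2 ^ Λ`.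
  have hgap : μ (⋃ i ∈ (Finset.univ : Finset (V × (Fin M → Fin Δ))) ×ˢ Finset.range (M + 1),
      {ω | (∀ j < i.2, G.Adj (labelWalk nbr i.1.1 i.1.2 j) (labelWalk nbr i.1.1 i.1.2 (j + 1))) ∧
        Set.InjOn (labelWalk nbr i.1.1 i.1.2) (Finset.range (i.2 + 1)) ∧
        2 * Δ * (60000 * Λ) ≤ ∑ j ∈ Finset.range i.2,
          gap (fun τ => conf τ ω) (fun τ => choice τ ω) (labelWalk nbr i.1.1 i.1.2 j)
            (labelWalk nbr i.1.1 i.1.2 (j + 1)) N}) ≤ (2 ^ (3 * Λ))⁻¹ := by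
    refine measure_iUnion_le_card μ _ _ (a := 11 * Λ) (n := 14 * Λ) (p := (2 ^ (14 * Λ))⁻¹) ?_ ?_
      le_rfl (by omega)
    · rw [Finset.card_product, Finset.card_univ, Fintype.card_prod, Fintype.card_fun,
        Fintype.card_fin, Fintype.card_fin, Finset.card_range]
      have e1 : Δ ^ M ≤ 2 ^ (6 * Λ) := by
        calc Δ ^ M ≤ Δ ^ (D * 6) := Nat.pow_le_pow_right hΔ (by omega)
          _ = (Δ ^ D) ^ 6 := pow_mul _ _ _
          _ ≤ (2 ^ Λ) ^ 6 := by
              refine Nat.pow_le_pow_left (le_trans ?_ hΔΛ) 6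
              exact Nat.pow_le_pow_left (Nat.le_succ Δ) D
          _ = 2 ^ (6 * Λ) := by rw [← pow_mul, mul_comm]
      have e2 : M + 1 ≤ 2 ^ (4 * Λ) := by
        calc M + 1 ≤ 8 * Λ := by omega
          _ ≤ 2 ^ 3 * 2 ^ Λ := Nat.mul_le_mul (by norm_num) Nat.lt_two_pow_self.le
          _ = 2 ^ (3 + Λ) := (pow_add _ _ _).symm
          _ ≤ 2 ^ (4 * Λ) := Nat.pow_le_pow_right (by norm_num) (by omega)
      calc _ ≤ 2 ^ Λ * 2 ^ (6 * Λ) * 2 ^ (4 * Λ) := Nat.mul_le_mul (Nat.mul_le_mul hcard e1) e2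
        _ = 2 ^ (11 * Λ) := by rw [← pow_add, ← pow_add]; congr 1; ring
    · rintro ⟨⟨z, a⟩, m⟩ hm
      have hmM : m ≤ M := by
        have := (Finset.mem_product.1 hm).2
        rw [Finset.mem_range] at this
        simp only at this
        omega
      by_cases hw : (∀ j < m, G.Adj (labelWalk nbr z a j) (labelWalk nbr z a (j + 1))) ∧
          Set.InjOn (labelWalk nbr z a) (Finset.range (m + 1))
      · refine (measure_mono fun ω hω => hω.2.2).trans
          ((h.measure_walk_gap_le hΔ hreg _ m N (60000 * Λ) hw.1 hw.2).trans ?_)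
        exact two_pow_mul_inv_le (by omega)
      · refine (measure_mono (t := ∅) fun ω hω => hw ⟨hω.1, hω.2.1⟩).trans ?_
        rw [measure_empty]
        exact zero_le
  rw [hN']
  refine (measure_mono (t := (_ ∪ _) ∪ (_ ∪ _)) ?_).trans ((measure_union_le _ _).trans
    ((add_le_add ((measure_union_le _ _).trans (add_le_add hload hreq))
      ((measure_union_le _ _).trans (add_le_add huse hgap))).trans ?_))
  · rintro ω ⟨hadj, hne⟩
    by_contra hno
    simp only [Set.mem_union, not_or, Set.mem_iUnion, Set.mem_ofPred_eq, not_exists, not_and,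
      not_le, not_lt, Finset.mem_product, Finset.mem_univ, true_and, Prod.forall] at hno
    obtain ⟨⟨h1, h2⟩, h3, h4⟩ := hno
    have hmem : ∀ r ≤ N, r ∈ T := fun r hr => by rw [hT, Finset.mem_range]; omega
    obtain ⟨queue, hrun⟩ := h.exists_isRun hadj
    refine hne (hrun.informed_eq_univ (Δ := Δ) hconn (O := O) (y := y) (D := D) hD hdist ?_ ?_ ?_ ?_ ?_ ?_)
    · have : 0 < 120000 * Δ * Λ := by positivity
      exact this
    · have e1 : D * Λ ≤ Δ * Λ := Nat.mul_le_mul_right _ hDΔ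
      calc M * (y + 2) ≤ (6 * D) * (72 * Λ) := Nat.mul_le_mul (by omega) (by omega)
        _ = 432 * (D * Λ) := by ring
        _ ≤ 120000 * (Δ * Λ) := by omega
        _ = O := by rw [hO]; ring
    · intro v r hr
      exact Nat.le_of_lt_succ (h1 v r (hmem r hr))
    · intro u b r hbr hr hhalf
      have := h2 u b (r - b) ⟨hmem b (by omega), hmem _ (by omega)⟩
      rw [Nat.add_sub_cancel' hbr] at this
      refine this fun τ hτ => hhalf.trans (Nat.mul_le_mul_left _ (Finset.card_le_card
        (Finset.monotone_filter_right _ fun w _ hw => ?_)))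
      exact hrun.informed_mono (Finset.mem_Ico.1 hτ).1 hw
    · intro u b r hbr hr hhalf
      have := h3 u b (r - b) ⟨hmem b (by omega), hmem _ (by omega)⟩
      rw [Nat.add_sub_cancel' hbr] at this
      exact this hhalf
    · intro m hm U hU hinj
      obtain ⟨a, ha⟩ := exists_labelWalk_eq (M := M) hΔ hnbr hm U hU
      have e1 := h4 (U 0) a m (by rw [Finset.mem_range]; omega) (fun j hj => by
        rw [ha j (by omega), ha (j + 1) (by omega)]; exact hU j hj) (by
        refine hinj.congr fun j hj => ?_
        simp only [Finset.coe_range, Set.mem_Iio] at hj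
        exact (ha j (by omega)).symm)
      have e2 : ∑ j ∈ Finset.range m, gap (fun τ => conf τ ω) (fun τ => choice τ ω)
          (labelWalk nbr (U 0) a j) (labelWalk nbr (U 0) a (j + 1)) N =
          ∑ j ∈ Finset.range m, gap (fun τ => conf τ ω) (fun τ => choice τ ω)
            (U j) (U (j + 1)) N := by
        refine Finset.sum_congr rfl fun j hj => ?_
        rw [Finset.mem_range] at hj
        rw [ha j (by omega), ha (j + 1) (by omega)]
      rw [e2] at e1
      have e3 : 2 * Δ * (60000 * Λ) = O := by rw [hO]; ring
      rw [e3] at e1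
      exact e1.le
  · have e1 : ((2 : ℝ≥0∞) ^ (3 * Λ))⁻¹ + (2 ^ (3 * Λ))⁻¹ + ((2 ^ (3 * Λ))⁻¹ + (2 ^ (3 * Λ))⁻¹) =
        2 ^ 2 * (2 ^ (3 * Λ))⁻¹ := by ring
    rw [e1]
    exact two_pow_mul_inv_le (by omega)

end IsExecution

/-! ### From the tail bound to the expectation -/

lemma spreadingTime_le_tsum {Ω : Type*} (conf : ℕ → Ω → Config V) (ω : Ω) {n : ℕ} (hn : 0 < n) :
    spreadingTime conf ω ≤
      ∑' k : ℕ, (n : ℝ≥0∞) * {ω | (conf (n * k) ω).informed ≠ Set.univ}.indicator 1 ω := by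
  classical
  by_cases hex : ∃ k, (conf (n * k) ω).informed = Set.univ
  · have hlt : ∀ k ∈ Finset.range (Nat.find hex),
        (n : ℝ≥0∞) * {ω | (conf (n * k) ω).informed ≠ Set.univ}.indicator 1 ω = n := by
      intro k hk
      rw [Set.indicator_of_mem (Nat.find_min hex (Finset.mem_range.1 hk)), Pi.one_apply, mul_one]
    refine (iInf₂_le (n * Nat.find hex) (Nat.find_spec hex)).trans
      (le_trans (le_of_eq ?_) (ENNReal.sum_le_tsum (Finset.range (Nat.find hex))))
    rw [Finset.sum_congr rfl hlt, Finset.sum_const, Finset.card_range, nsmul_eq_mul, mul_comm n,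
      Nat.cast_mul]
  · have hall : ∀ k,
        (n : ℝ≥0∞) * {ω | (conf (n * k) ω).informed ≠ Set.univ}.indicator 1 ω = n := by
      intro k
      rw [Set.indicator_of_mem, Pi.one_apply, mul_one]
      exact fun he => hex ⟨k, he⟩
    rw [tsum_congr hall, ENNReal.tsum_const_eq_top_of_ne_zero (by exact_mod_cast hn.ne')]
    exact le_top

/-- Both summands are at most `log Δ / log 2`, and `2 / log 2 < 3`. -/
lemma log_two_add_one_le {Δ : ℕ} (hΔ : 2 ≤ Δ) :
    ((Nat.log 2 Δ + 1 : ℕ) : ℝ) ≤ 3 * Real.log Δ := by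
  have h2 : (0 : ℝ) < Real.log 2 := Real.log_pos one_lt_two
  have hlog : (Nat.log 2 Δ : ℝ) * Real.log 2 ≤ Real.log Δ := by
    rw [← Real.log_pow]
    exact Real.log_le_log (by positivity)
      (by exact_mod_cast Nat.pow_log_le_self 2 (by omega : Δ ≠ 0))
  have hone : Real.log 2 ≤ Real.log Δ :=
    Real.log_le_log two_pos (by exact_mod_cast hΔ)
  have := Real.log_two_gt_d9
  push_cast
  nlinarith [Nat.cast_nonneg (α := ℝ) (Nat.log 2 Δ)]

namespace IsExecution
variable [Fintype V] {G : SimpleGraph V} [DecidableRel G.Adj] {s : V} {Δ D Λ : ℕ}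
    {Ω : Type*} [mΩ : MeasurableSpace Ω] {μ : Measure Ω}
    {ℱ : Filtration ℕ mΩ} {choice : ℕ → Ω → V → V} {conf : ℕ → Ω → Config V}

/-- A geometric tail of the spreading time bounds its expectation. -/
lemma lintegral_spreadingTime_le (h : IsExecution G s μ ℱ choice conf) {n : ℕ} (hn0 : 0 < n)
    (hn : ∀ k, μ {ω | (conf (n * k) ω).informed ≠ Set.univ} ≤ (2 ^ k)⁻¹) :
    ∫⁻ ω, spreadingTime conf ω ∂μ ≤ n * 2 := by
  have hmeas : ∀ k, MeasurableSet {ω | (conf (n * k) ω).informed ≠ Set.univ} := fun k =>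
    ℱ.le _ _ (h.conf_adapted (n * k) {σ | σ.informed ≠ Set.univ})
  calc ∫⁻ ω, spreadingTime conf ω ∂μ
      ≤ ∫⁻ ω, ∑' k : ℕ, (n : ℝ≥0∞) *
          {ω | (conf (n * k) ω).informed ≠ Set.univ}.indicator 1 ω ∂μ :=
        lintegral_mono fun ω => spreadingTime_le_tsum conf ω hn0
    _ = ∑' k : ℕ, (n : ℝ≥0∞) * μ {ω | (conf (n * k) ω).informed ≠ Set.univ} := by
        rw [lintegral_tsum fun k =>
          ((measurable_one.indicator (hmeas k)).const_mul _).aemeasurable]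
        refine tsum_congr fun k => ?_
        rw [lintegral_const_mul _ (measurable_one.indicator (hmeas k)),
          lintegral_indicator_one (hmeas k)]
    _ ≤ ∑' k : ℕ, (n : ℝ≥0∞) * (2⁻¹ : ℝ≥0∞) ^ k := by
        refine ENNReal.tsum_le_tsum fun k => mul_le_mul_right ((hn k).trans_eq ?_) _
        rw [ENNReal.inv_pow]
    _ = n * 2 := by
        rw [ENNReal.tsum_mul_left, ENNReal.tsum_geometric, ENNReal.one_sub_inv_two, inv_inv]

variable [IsProbabilityMeasure μ]

/-- The probability that some node is informed late. -/
lemma measure_late_le (h : IsExecution G s μ ℱ choice conf) (hΔ : 0 < Δ)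
    (hreg : G.IsRegularOfDegree Δ) (hconn : G.Connected) (hdist : ∀ v, G.dist s v ≤ D)
    (hD : 0 < D) (hΛ : D * (Nat.log 2 Δ + 1) ≤ Λ) :
    μ {ω | (conf (60000000 * D * Δ * Λ) ω).informed ≠ Set.univ} ≤ (2 ^ Λ)⁻¹ := by
  have hdeg : ∀ v, 0 < G.degree v := fun v => by rw [hreg.degree_eq]; exact hΔ
  have hDΛ : D ≤ Λ := (Nat.le_mul_of_pos_right _ (Nat.succ_pos _)).trans hΛ
  have hΔΛ : (Δ + 1) ^ D ≤ 2 ^ Λ := by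
    calc (Δ + 1) ^ D ≤ (2 ^ (Nat.log 2 Δ + 1)) ^ D :=
          Nat.pow_le_pow_left (Nat.lt_pow_succ_log_self (by norm_num) Δ) D
      _ = 2 ^ (D * (Nat.log 2 Δ + 1)) := by rw [← pow_mul, mul_comm]
      _ ≤ 2 ^ Λ := Nat.pow_le_pow_right (by norm_num) hΛ
  have hae : μ {ω | (conf (60000000 * D * Δ * Λ) ω).informed ≠ Set.univ} ≤
      μ {ω | (∀ t v, G.Adj v (choice t ω v)) ∧
        (conf (60000000 * D * Δ * Λ) ω).informed ≠ Set.univ} := by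
    refine measure_mono_ae ?_
    filter_upwards [h.ae_adj hdeg] with ω hω hne
    exact ⟨hω, hne⟩
  refine hae.trans ?_
  rcases le_total Δ D with hle | hle
  · refine le_trans (measure_mono ?_) (h.measure_late_le_of_degree_le hΔ hreg hconn hdist hle hDΛ
      ((card_le_pow hconn hreg hdist).trans hΔΛ))
    rintro ω ⟨hadj, hne⟩
    refine ⟨hadj, fun he => hne ?_⟩
    obtain ⟨queue, hrun⟩ := h.exists_isRun hadj
    refine Set.eq_univ_of_univ_subset ?_
    rw [← he]
    refine hrun.informed_mono ?_
    have e1 : 1280 * D * Δ * Λ = 1280 * (D * Δ * Λ) := by ring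
    have e2 : 60000000 * D * Δ * Λ = 60000000 * (D * Δ * Λ) := by ring
    omega
  · exact h.measure_late_le_of_le_degree hΔ hreg hconn hdist hD hle hDΛ hΔΛ

end IsExecution
end BufferPull

theorem theoremt :
    ∃ C : ℝ, ∀ (V : Type*) [Fintype V] (G : SimpleGraph V) [DecidableRel G.Adj] (Δ : ℕ),
      2 ≤ Δ → G.Connected → G.IsRegularOfDegree Δ →
      ∀ (s : V) (Ω : Type*) [mΩ : MeasurableSpace Ω] (μ : Measure Ω) [IsProbabilityMeasure μ]
        (ℱ : Filtration ℕ mΩ) (choice : ℕ → Ω → V → V) (conf : ℕ → Ω → BufferPull.Config V),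
        BufferPull.IsExecution G s μ ℱ choice conf →
        ∫⁻ ω, BufferPull.spreadingTime conf ω ∂μ ≤
          ENNReal.ofReal (C * (G.diam : ℝ) ^ 2 * (Δ : ℝ) * Real.log (Δ : ℝ)) := by
  refine ⟨360000000, fun V _ G _ Δ hΔ hconn hreg s Ω _ μ _ ℱ choice conf h => ?_⟩
  have hne : Nonempty V := ⟨s⟩
  have hnt : Nontrivial V := by
    obtain ⟨v, hv⟩ := (G.degree_pos_iff_exists_adj s).1 (by rw [hreg.degree_eq]; omega)
    exact ⟨s, v, hv.ne⟩
  have hD : 0 < G.diam := Nat.pos_of_ne_zero (SimpleGraph.connected_iff_diam_ne_zero.1 hconn)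
  have hdist : ∀ v, G.dist s v ≤ G.diam := fun v =>
    SimpleGraph.dist_le_diam (SimpleGraph.connected_iff_ediam_ne_top.1 hconn)
  set D := G.diam
  have hL : 0 < D * (Nat.log 2 Δ + 1) := Nat.mul_pos hD (Nat.succ_pos _)
  -- Time `n * k` corresponds to `Λ = D * (Nat.log 2 Δ + 1) * k`, which is admissible for every `k ≥
  -- 1`. For `k = 0` the tail bound is trivial.
  refine (h.lintegral_spreadingTime_le
    (n := 60000000 * D * Δ * (D * (Nat.log 2 Δ + 1))) (by positivity) fun k => ?_).trans ?_
  · rcases Nat.eq_zero_or_pos k with rfl | hk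
    · simpa using prob_le_one
    · have hle : D * (Nat.log 2 Δ + 1) ≤ D * (Nat.log 2 Δ + 1) * k := Nat.le_mul_of_pos_right _ hk
      rw [mul_assoc (60000000 * D * Δ)]
      refine (h.measure_late_le (by omega) hreg hconn hdist hD hle).trans
        (ENNReal.inv_le_inv.2 (pow_le_pow_right₀ one_le_two ?_))
      exact Nat.le_mul_of_pos_left _ hL
  · have hlog := BufferPull.log_two_add_one_le hΔ
    rw [← Nat.cast_ofNat (R := ℝ≥0∞) (n := 2), ← Nat.cast_mul, ← ENNReal.ofReal_natCast]
    refine ENNReal.ofReal_le_ofReal ?_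
    calc ((60000000 * D * Δ * (D * (Nat.log 2 Δ + 1)) * 2 : ℕ) : ℝ)
        = 120000000 * (D : ℝ) ^ 2 * Δ * ((Nat.log 2 Δ + 1 : ℕ) : ℝ) := by push_cast; ring
      _ ≤ 120000000 * (D : ℝ) ^ 2 * Δ * (3 * Real.log Δ) := by gcongr
      _ = 360000000 * (D : ℝ) ^ 2 * Δ * Real.log Δ := by ring
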